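/- Consider smooth closed immersed curves $c:\mathbb{S}^1\to\mathbb{R}^2$, with arc-length derivative $\partial_s$, unit tangent $\tau=\partial_s c$, unit normal $\nu$ ($\tau$ turned by $+\pi/2$) and curvature $k$ given by $\partial_s\tau=k\nu$. The curve diffusion flow moves a curve with normal velocity $-k_{ss}$. There are $m_0<\infty$ and, for every integer $m>m_0$, a smooth closed immersed curve $\gamma_m:\mathbb{S}^1\to\mathbb{R}^2$ (an "epicyclic shrinker") with the following properties. (i) $\gamma_m$ is a homothetic shrinker for the curve diffusion flow with centre the origin: there is $\sigma<0$ with $k_{ss}=-\sigma\,\langle\gamma_m,\nu\rangle$ along $\gamma_m$, and, for some $T\in(0,\infty)$ and some function $\rho:[0,T)\to(0,1]$ that decreases strictly from $\rho(0)=1$ to $0$ as $t\nearrow T$, the family $\rho(t)\gamma_m$, $0\le t<T$, is a smooth solution of the curve diffusion flow. (ii) $\gamma_m$ has dihedral symmetry of order $m$: for the group $D_m$ of the $2m$ symmetries of some regular $m$-gon centred at the origin, each element of $D_m$ maps $\gamma_m$ to a reparametrisation of $\gamma_m$ by a diffeomorphism of $\mathbb{S}^1$, and every isometry of the plane that preserves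 the image of $\gamma_m$ lies in $D_m$. (iii) The curves are pairwise non-similar: if $m\ne n$ (both $>m_0$), then no similarity transformation of the plane maps the image of $\gamma_m$ onto the image of $\gamma_n$. -/

import Mathlib

open Set Filter Topology
open scoped ContDiff

noncomputable section

/-- A smooth closed immersed curve in the plane `ℝ² = ℂ`, that is, a smooth immersion of the circle
`ℝ / 2πℤ`, given as a `2π`-periodic smooth map on the line with nowhere vanishing derivative. -/
structure IsSmoothClosedCurve (c : ℝ → ℂ) : Prop where
  smooth : ContDiff ℝ ∞ c
  periodic : Function.Periodic c (2 * Real.pi)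
  immersed : ∀ u, deriv c u ≠ 0

/-- The derivative `∂ₛ f = |c'|⁻¹ f'` with respect to the arc length of `c` of a function `f` of the
parameter of `c`. -/
def arcDeriv {F : Type*} [NormedAddCommGroup F] [NormedSpace ℝ F] (c : ℝ → ℂ) (f : ℝ → F) :
    ℝ → F :=
  fun u => ‖deriv c u‖⁻¹ • deriv f u

/-- The unit tangent `τ = ∂ₛ c`. -/
def unitTangent (c : ℝ → ℂ) : ℝ → ℂ := arcDeriv c c

/-- The unit normal `ν`, the unit tangent turned by `π / 2`. -/
def unitNormal (c : ℝ → ℂ) : ℝ → ℂ := fun u => Complex.I * unitTangent c u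

/-- The scalar curvature `k = ⟨∂ₛ τ, ν⟩` (so that `∂ₛ τ = k ν`). -/
def curvature (c : ℝ → ℂ) : ℝ → ℝ :=
  fun u => inner ℝ (arcDeriv c (unitTangent c) u) (unitNormal c u)

/-- The second arc length derivative `kₛₛ` of the curvature; it is the (scalar) `H⁻¹(ds)` gradient
of length. -/
def curvatureSS (c : ℝ → ℂ) : ℝ → ℝ := arcDeriv c (arcDeriv c (curvature c))

/-- `Γ t`, `0 ≤ t < T`, is a smooth family of smooth closed immersed curves moving by curve
diffusion: its normal velocity is `-kₛₛ`. -/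
structure IsCurveDiffusionFlow (T : ℝ) (Γ : ℝ → ℝ → ℂ) : Prop where
  smooth : ContDiffOn ℝ ∞ (fun p : ℝ × ℝ => Γ p.1 p.2) (Ico 0 T ×ˢ univ)
  closed : ∀ t ∈ Ico 0 T, IsSmoothClosedCurve (Γ t)
  normal_velocity : ∀ t ∈ Ico 0 T, ∀ u,
    inner ℝ (derivWithin (fun r => Γ r u) (Ico 0 T) t) (unitNormal (Γ t) u) = -curvatureSS (Γ t) u

/-- A smooth closed homothetic shrinker for the curve diffusion flow, with centre the origin: it
satisfies the profile equation `kₛₛ = -σ ⟨c, ν⟩` for some `σ < 0`, and the curve diffusion flow that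
it generates is `ρ(t) c` with a scaling factor `ρ` that decreases from `1` to `0` in finite time. -/
structure IsHomotheticShrinker (c : ℝ → ℂ) : Prop where
  closed : IsSmoothClosedCurve c
  profile : ∃ σ : ℝ, σ < 0 ∧ ∀ u, curvatureSS c u = -σ * inner ℝ (c u) (unitNormal c u)
  shrinks : ∃ (T : ℝ) (ρ : ℝ → ℝ), 0 < T ∧ ρ 0 = 1 ∧ (∀ t ∈ Ico 0 T, 0 < ρ t) ∧
    StrictAntiOn ρ (Ico 0 T) ∧ Tendsto ρ (𝓝[<] T) (𝓝 0) ∧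
    IsCurveDiffusionFlow T (fun t u => ρ t • c u)

/-- The reflection of the plane in the line through the origin and `exp (i β)`. -/
def lineReflection (β : ℝ) : ℂ ≃ₗᵢ[ℝ] ℂ :=
  Complex.conjLIE.trans (rotation (Circle.exp (2 * β)))

/-- The dihedral group of symmetries of a regular `m`-gon (`2 m` elements if `1 ≤ m`) centred at the
origin, one of whose reflection axes has direction `exp (i β)`. -/
def planeDihedralGroup (m : ℕ) (β : ℝ) : Subgroup (ℂ ≃ₗᵢ[ℝ] ℂ) :=
  Subgroup.closure {rotation (Circle.exp (2 * Real.pi / m)), lineReflection β}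

/-- `φ` is the lift to the line of a diffeomorphism of the circle `ℝ / 2πℤ`. -/
structure IsCircleReparam (φ : ℝ → ℝ) : Prop where
  smooth : ContDiff ℝ ∞ φ
  deriv_ne_zero : ∀ u, deriv φ u ≠ 0
  equivariant : (∀ u, φ (u + 2 * Real.pi) = φ u + 2 * Real.pi) ∨
    (∀ u, φ (u + 2 * Real.pi) = φ u - 2 * Real.pi)

/-- The closed curve `c` has dihedral symmetry of order `m` about the origin: for a suitable choice
of axes, each element of the dihedral group maps `c` to a reparametrisation of `c`, and there are no
further isometries of the plane that preserve the image of `c`. -/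
def HasDihedralSymmetry (c : ℝ → ℂ) (m : ℕ) : Prop :=
  ∃ β : ℝ,
    (∀ g ∈ planeDihedralGroup m β, ∃ φ : ℝ → ℝ, IsCircleReparam φ ∧ ∀ u, g (c u) = c (φ u)) ∧
    (∀ f : ℂ ≃ᵢ ℂ, f '' range c = range c → ∃ g ∈ planeDihedralGroup m β, ∀ z, f z = g z)

/-- Some similarity transformation of the plane maps the image of `c₁` onto the image of `c₂`. -/
def AreSimilar (c₁ c₂ : ℝ → ℂ) : Prop :=
  ∃ f : ℂ ≃ᵈ ℂ, f '' range c₁ = range c₂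

end

/-! Describe a locally convex curve by its support function `h` in terms of the tangent angle `θ`,
so that `γ = h_θ τ - h ν`, the radius of curvature is `w = h + h_θθ`, and `⟨γ, ν⟩ = -h`. Since `∂ₛ =
w⁻¹ ∂_θ`, the shrinker equation with `σ = -ε` becomes `(w⁻²)_θθ = -2 ε h w`. A curve whose tangent
turns `m - 1` times and which has `m`-fold symmetry corresponds to an even `2π`-periodic function of
`x = l θ`, `l = m / (m - 1)`, and then `∂_θ = l ∂_x`. As `m → ∞`, `l → 1`, the resonance at which
`cos x` lies in the kernel of `1 + l² ∂_x²`; there `cos` is the support function of a translation.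

With `δ² = l² - 1`, the solutions sought are nearly unit circles whose centres travel along a large
circle: `h = (a/δ) cos x + 1 + O(δ)`, `w = 1 + δ z`, `ε = e δ²`. The term `(a/δ) cos x` contributes
only `-a δ cos x` to `w`, so after division by powers of `δ` the problem has a regular limit at `δ =
0` (`profileMap`). The limit is solved explicitly by `basePoint`, its linearisation is onto
(`range_fderiv_profileMap`), and the local surjectivity theorem in a Banach space gives solutions
for small `δ` (`eventually_exists_profile`). Bootstrapping makes them smooth.

For the symmetries, `(|γ|²)_x = 2 h' w`, and `h' < 0` on `(0, π)` because the large cosine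
dominates. Hence the points of maximal modulus are exactly the vertices of a regular `m`-gon
(`hasPolygonalTop_epicycle`). The centre of the smallest enclosing disc is the origin, so a
similarity between two such images fixes the origin and carries vertices to vertices. This bounds
the isometry group by the dihedral group and makes the number of vertices a similarity invariant. -/

namespace EpicyclicShrinker

/-! ### Even periodic functions as functions of the cosine -/

/-- Continuous functions on `[-1, 1]`. Through `x ↦ f (cos x)` they represent the continuous even
`2π`-periodic functions on the line. -/
abbrev CosSpace : Type := C(Icc (-1 : ℝ) 1, ℝ)

/-- The even `2π`-periodic function on the line given by an element of `CosSpace`. -/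
noncomputable def lift (f : CosSpace) (x : ℝ) : ℝ := f ⟨Real.cos x, Real.cos_mem_Icc x⟩

/-- The element of `CosSpace` that represents the cosine. -/
def cosElt : CosSpace := ⟨fun c => c, continuous_subtype_val⟩

@[simp] lemma lift_cosElt (x : ℝ) : lift cosElt x = Real.cos x := rfl
@[simp] lemma lift_one (x : ℝ) : lift 1 x = 1 := rfl
@[simp] lemma lift_zero (x : ℝ) : lift 0 x = 0 := rfl
@[simp] lemma lift_add (f g : CosSpace) (x : ℝ) : lift (f + g) x = lift f x + lift g x := rfl
@[simp] lemma lift_sub (f g : CosSpace) (x : ℝ) : lift (f - g) x = lift f x - lift g x := rfl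
@[simp] lemma lift_mul (f g : CosSpace) (x : ℝ) : lift (f * g) x = lift f x * lift g x := rfl
@[simp] lemma lift_smul (r : ℝ) (f : CosSpace) (x : ℝ) : lift (r • f) x = r * lift f x := rfl
@[simp] lemma lift_pow (f : CosSpace) (n : ℕ) (x : ℝ) : lift (f ^ n) x = lift f x ^ n := by
  simp [lift]

@[fun_prop] lemma continuous_lift (f : CosSpace) : Continuous (lift f) := by
  unfold lift; fun_prop

lemma even_lift (f : CosSpace) : Function.Even (lift f) := fun x => by simp [lift]

lemma periodic_lift (f : CosSpace) : Function.Periodic (lift f) (2 * Real.pi) := fun x => by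
  simp [lift]

lemma abs_lift_le (f : CosSpace) (x : ℝ) : |lift f x| ≤ ‖f‖ := f.norm_coe_le_norm _

lemma norm_le_of_forall_lift {f : CosSpace} {C : ℝ} (hC : ∀ x, |lift f x| ≤ C) : ‖f‖ ≤ C := by
  rw [ContinuousMap.norm_le _ ((abs_nonneg _).trans (hC 0))]
  rintro ⟨c, hc⟩
  have := hC (Real.arccos c)
  simpa only [lift, Real.cos_arccos hc.1 hc.2, Real.norm_eq_abs] using this

lemma lift_injective : Function.Injective lift := by
  intro f g h
  ext ⟨c, hc⟩
  have := congrFun h (Real.arccos c)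
  simpa only [lift, Real.cos_arccos hc.1 hc.2] using this

lemma apply_arccos_cos {Φ : ℝ → ℝ} (he : Function.Even Φ) (hp : Function.Periodic Φ (2 * Real.pi))
    (x : ℝ) : Φ (Real.arccos (Real.cos x)) = Φ x := by
  have h : Real.cos (Real.arccos (Real.cos x)) = Real.cos x :=
    Real.cos_arccos (Real.neg_one_le_cos x) (Real.cos_le_one x)
  obtain ⟨k, hk | hk⟩ := Real.cos_eq_cos_iff.1 h
  · rw [show Φ x = Φ (Real.arccos (Real.cos x) + k * (2 * Real.pi)) by
      congr 1; linarith, hp.int_mul k]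
  · rw [show Φ x = Φ (k * (2 * Real.pi) - Real.arccos (Real.cos x)) by
      congr 1; linarith, sub_eq_neg_add, hp.int_mul k, he]

/-- A bounded linear family of continuous even `2π`-periodic functions gives a bounded operator. -/
lemma exists_operator (Λ : CosSpace → ℝ → ℝ) (hadd : ∀ f g x, Λ (f + g) x = Λ f x + Λ g x)
    (hsmul : ∀ (r : ℝ) f x, Λ (r • f) x = r * Λ f x) (hcont : ∀ f, Continuous (Λ f))
    (heven : ∀ f, Function.Even (Λ f)) (hper : ∀ f, Function.Periodic (Λ f) (2 * Real.pi))
    (C : ℝ) (hC : ∀ f, ∀ x ∈ Icc 0 Real.pi, |Λ f x| ≤ C * ‖f‖) :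
    ∃ T : CosSpace →L[ℝ] CosSpace, ∀ f x, lift (T f) x = Λ f x := by
  let T₀ : CosSpace → CosSpace := fun f =>
    ⟨fun c => Λ f (Real.arccos c), (hcont f).comp (Real.continuous_arccos.comp continuous_subtype_val)⟩
  have hT₀ : ∀ f x, lift (T₀ f) x = Λ f x := fun f x => apply_arccos_cos (heven f) (hper f) x
  let T₁ : CosSpace →ₗ[ℝ] CosSpace :=
    { toFun := T₀
      map_add' := fun f g => lift_injective (funext fun x => by simp [hT₀, hadd])
      map_smul' := fun r f => lift_injective (funext fun x => by simp [hT₀, hsmul]) }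
  refine ⟨T₁.mkContinuous C fun f => ?_, hT₀⟩
  refine norm_le_of_forall_lift fun x => ?_
  change |lift (T₀ f) x| ≤ _
  rw [hT₀, ← apply_arccos_cos (heven f) (hper f) x]
  -- By evenness and periodicity every value is attained on `[0, π]`, so a bound there suffices.
  exact hC f _ ⟨Real.arccos_nonneg _, Real.arccos_le_pi _⟩

/-! ### Primitives of even and odd periodic functions -/

lemma hasDerivAt_primitive {φ : ℝ → ℝ} (hφ : Continuous φ) (x : ℝ) :
    HasDerivAt (fun x => ∫ t in (0 : ℝ)..x, φ t) (φ x) x :=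
  (hφ.integral_hasStrictDerivAt 0 x).hasDerivAt

lemma odd_primitive {φ : ℝ → ℝ} (he : Function.Even φ) :
    Function.Odd (fun x => ∫ t in (0 : ℝ)..x, φ t) := fun x => by
  have := intervalIntegral.integral_comp_neg (a := 0) (b := x) φ
  simp only [he _, neg_zero] at this
  simp only
  rw [this, ← intervalIntegral.integral_symm]

lemma even_primitive {φ : ℝ → ℝ} (ho : Function.Odd φ) :
    Function.Even (fun x => ∫ t in (0 : ℝ)..x, φ t) := fun x => by
  have := intervalIntegral.integral_comp_neg (a := 0) (b := x) φ
  simp only [ho _, neg_zero, intervalIntegral.integral_neg] at this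
  simp only
  rw [intervalIntegral.integral_symm, ← this, neg_neg]

lemma periodic_primitive {φ : ℝ → ℝ} (hφ : Continuous φ) (hp : Function.Periodic φ (2 * Real.pi))
    (h : ∫ t in (-Real.pi)..Real.pi, φ t = 0) :
    Function.Periodic (fun x => ∫ t in (0 : ℝ)..x, φ t) (2 * Real.pi) := fun x => by
  have h1 := hp.intervalIntegral_add_eq x (-Real.pi)
  rw [show -Real.pi + 2 * Real.pi = Real.pi by ring, h] at h1
  simp only
  rw [← intervalIntegral.integral_add_adjacent_intervals (hφ.intervalIntegrable 0 x)
    (hφ.intervalIntegrable x _), h1, add_zero]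

lemma integral_symmetric_of_odd {φ : ℝ → ℝ} (hφ : Continuous φ) (ho : Function.Odd φ) :
    ∫ t in (-Real.pi)..Real.pi, φ t = 0 := by
  rw [← intervalIntegral.integral_add_adjacent_intervals (hφ.intervalIntegrable _ 0)
    (hφ.intervalIntegrable 0 _), intervalIntegral.integral_symm,
    show ∫ t in (0 : ℝ)..(-Real.pi), φ t = ∫ t in (0 : ℝ)..Real.pi, φ t from
      even_primitive ho Real.pi, neg_add_cancel]

lemma integral_symmetric_of_even {φ : ℝ → ℝ} (hφ : Continuous φ) (he : Function.Even φ)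
    (h : ∫ t in (0 : ℝ)..Real.pi, φ t = 0) : ∫ t in (-Real.pi)..Real.pi, φ t = 0 := by
  rw [← intervalIntegral.integral_add_adjacent_intervals (hφ.intervalIntegrable _ 0)
    (hφ.intervalIntegrable 0 _), intervalIntegral.integral_symm,
    show ∫ t in (0 : ℝ)..(-Real.pi), φ t = -∫ t in (0 : ℝ)..Real.pi, φ t from
      odd_primitive he Real.pi, h]
  simp

lemma abs_primitive_le {φ : ℝ → ℝ} {C : ℝ} (hC : ∀ x, |φ x| ≤ C) (a x : ℝ) :
    |∫ t in a..x, φ t| ≤ C * |x - a| :=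
  intervalIntegral.norm_integral_le_of_norm_le_const (f := φ) fun t _ => hC t

/-! ### Mean value, first cosine coefficient, and two Green operators -/

lemma exists_functional (ψ : ℝ → ℝ) (hψ : Continuous ψ) (hψ1 : ∀ x, |ψ x| ≤ 1) :
    ∃ L : CosSpace →L[ℝ] ℝ, ∀ f, L f = ∫ t in (0 : ℝ)..Real.pi, lift f t * ψ t := by
  let L₁ : CosSpace →ₗ[ℝ] ℝ :=
    { toFun := fun f => ∫ t in (0 : ℝ)..Real.pi, lift f t * ψ t
      map_add' := fun f g => by
        rw [← intervalIntegral.integral_add]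
        · simp [add_mul]
        all_goals exact Continuous.intervalIntegrable (by fun_prop) _ _
      map_smul' := fun r f => by
        simp [mul_assoc] }
  refine ⟨L₁.mkContinuous Real.pi fun f => ?_, fun f => rfl⟩
  have := abs_primitive_le (φ := fun t => lift f t * ψ t) (C := ‖f‖) (fun x => by
    rw [abs_mul]
    exact (mul_le_mul (abs_lift_le f x) (hψ1 x) (abs_nonneg _) (norm_nonneg _)).trans_eq
      (mul_one _)) 0 Real.pi
  rw [sub_zero, abs_of_pos Real.pi_pos, mul_comm] at this
  exact this

/-- The mean value over a period. -/
noncomputable def mean : CosSpace →L[ℝ] ℝ :=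
  Real.pi⁻¹ • (exists_functional (fun _ => 1) continuous_const (by simp)).choose

/-- The first cosine coefficient. -/
noncomputable def cosCoeff : CosSpace →L[ℝ] ℝ :=
  (2 / Real.pi) • (exists_functional Real.cos Real.continuous_cos Real.abs_cos_le_one).choose

lemma mean_apply (f : CosSpace) : mean f = Real.pi⁻¹ * ∫ t in (0 : ℝ)..Real.pi, lift f t := by
  rw [mean, smul_apply, smul_eq_mul,
    (exists_functional (fun _ => 1) continuous_const (by simp)).choose_spec f]
  simp only [mul_one]

lemma cosCoeff_apply (f : CosSpace) :
    cosCoeff f = 2 / Real.pi * ∫ t in (0 : ℝ)..Real.pi, lift f t * Real.cos t := by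
  rw [← (exists_functional Real.cos Real.continuous_cos Real.abs_cos_le_one).choose_spec f,
    cosCoeff, smul_apply, smul_eq_mul]

lemma mean_one : mean 1 = 1 := by
  simp [mean_apply, Real.pi_ne_zero]

lemma mean_cosElt : mean cosElt = 0 := by
  simp [mean_apply]

lemma mean_cosElt_mul (f : CosSpace) : mean (cosElt * f) = cosCoeff f / 2 := by
  rw [mean_apply, cosCoeff_apply]
  simp only [lift_mul, lift_cosElt, mul_comm (Real.cos _)]
  ring

lemma cosCoeff_one : cosCoeff 1 = 0 := by
  simp [cosCoeff_apply]

lemma cosCoeff_cosElt : cosCoeff cosElt = 1 := by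
  simp only [cosCoeff_apply, lift_cosElt, ← sq, integral_cos_sq]
  simp [Real.pi_ne_zero]

/-- The projection that removes the first cosine mode. -/
noncomputable def removeCos : CosSpace →L[ℝ] CosSpace :=
  ContinuousLinearMap.id ℝ _ - cosCoeff.smulRight cosElt

lemma removeCos_apply (f : CosSpace) : removeCos f = f - cosCoeff f • cosElt := rfl

lemma cosCoeff_removeCos (f : CosSpace) : cosCoeff (removeCos f) = 0 := by
  simp [removeCos_apply, cosCoeff_cosElt]

/-- The constant is `1 + 2`, since the normalising factor `2 / π` gives `|cosCoeff f| ≤ 2 ‖f‖`. -/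
lemma norm_removeCos_le (f : CosSpace) : ‖removeCos f‖ ≤ 3 * ‖f‖ := by
  have h1 : |cosCoeff f| ≤ 2 * ‖f‖ := by
    have := abs_primitive_le (φ := fun t => lift f t * Real.cos t) (C := ‖f‖) (fun x => by
      rw [abs_mul]
      exact (mul_le_mul (abs_lift_le f x) (Real.abs_cos_le_one x) (abs_nonneg _)
        (norm_nonneg _)).trans_eq (mul_one _)) 0 Real.pi
    rw [sub_zero, abs_of_pos Real.pi_pos] at this
    rw [cosCoeff_apply, abs_mul, abs_of_pos (by positivity)]
    calc _ ≤ 2 / Real.pi * (‖f‖ * Real.pi) := by gcongr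
      _ = _ := by field_simp
  refine norm_le_of_forall_lift fun x => ?_
  rw [removeCos_apply, lift_sub, lift_smul, lift_cosElt]
  calc _ ≤ |lift f x| + |cosCoeff f * Real.cos x| := abs_sub _ _
    _ ≤ ‖f‖ + 2 * ‖f‖ * 1 := by
      rw [abs_mul]
      gcongr
      exacts [abs_lift_le f x, Real.abs_cos_le_one x]
    _ = _ := by ring

/-- The operator that solves `v'' = f - mean f`. -/
lemma exists_doublePrimitive : ∃ G : CosSpace →L[ℝ] CosSpace, G cosElt = 1 - cosElt ∧
    ∀ f, ∃ A : ℝ → ℝ, (∀ x, HasDerivAt (lift (G f)) (A x) x) ∧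
      ∀ x, HasDerivAt A (lift f x - mean f) x := by
  let φ : CosSpace → ℝ → ℝ := fun f t => lift f t - mean f
  let A : CosSpace → ℝ → ℝ := fun f x => ∫ t in (0 : ℝ)..x, φ f t
  -- Integrating from `0` selects the solution vanishing at `0`. In the profile equation this
  -- normalises `w 0 = 1`, which removes the freedom of scaling.
  let B : CosSpace → ℝ → ℝ := fun f x => ∫ t in (0 : ℝ)..x, A f t
  have hφc : ∀ f, Continuous (φ f) := fun f => by fun_prop
  have hφe : ∀ f, Function.Even (φ f) := fun f x => by simp only [φ, even_lift f x]
  have hφp : ∀ f, Function.Periodic (φ f) (2 * Real.pi) := fun f x => by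
    simp only [φ, periodic_lift f x]
  have hφ0 : ∀ f, ∫ t in (0 : ℝ)..Real.pi, φ f t = 0 := fun f => by
    simp only [φ]
    rw [intervalIntegral.integral_sub ((continuous_lift f).intervalIntegrable _ _)
      (by simp), intervalIntegral.integral_const, mean_apply]
    simp [Real.pi_ne_zero]
  have hA : ∀ f x, HasDerivAt (A f) (φ f x) x := fun f => hasDerivAt_primitive (hφc f)
  have hAc : ∀ f, Continuous (A f) := fun f =>
    continuous_iff_continuousAt.2 fun x => (hA f x).continuousAt
  have hAo : ∀ f, Function.Odd (A f) := fun f => odd_primitive (hφe f)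
  have hAp : ∀ f, Function.Periodic (A f) (2 * Real.pi) := fun f =>
    periodic_primitive (hφc f) (hφp f) (integral_symmetric_of_even (hφc f) (hφe f) (hφ0 f))
  have hB : ∀ f x, HasDerivAt (B f) (A f x) x := fun f => hasDerivAt_primitive (hAc f)
  have hmean : ∀ f, |mean f| ≤ ‖f‖ := fun f => by
    have := abs_primitive_le (abs_lift_le f) 0 Real.pi
    rw [sub_zero, abs_of_pos Real.pi_pos] at this
    rw [mean_apply, abs_mul, abs_of_pos (by positivity)]
    calc _ ≤ Real.pi⁻¹ * (‖f‖ * Real.pi) := by gcongr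
      _ = _ := by field_simp
  have hφb : ∀ f x, |φ f x| ≤ 2 * ‖f‖ := fun f x =>
    (abs_sub _ _).trans (by linarith [hmean f, abs_lift_le f x])
  have hAb' : ∀ f, ∀ x ∈ Icc 0 Real.pi, |A f x| ≤ 2 * ‖f‖ * Real.pi := fun f x hx =>
    (abs_primitive_le (hφb f) 0 x).trans (by
      rw [sub_zero, abs_of_nonneg hx.1]
      exact mul_le_mul_of_nonneg_left hx.2 (by positivity))
  have hAadd : ∀ f g x, A (f + g) x = A f x + A g x := fun f g x => by
    simp only [A]
    rw [← intervalIntegral.integral_add ((hφc f).intervalIntegrable _ _)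
      ((hφc g).intervalIntegrable _ _)]
    congr 1; funext t; simp [φ]; ring
  have hAsmul : ∀ (r : ℝ) f x, A (r • f) x = r * A f x := fun r f x => by
    simp only [A]
    rw [← intervalIntegral.integral_const_mul]
    congr 1; funext t; simp [φ]; ring
  obtain ⟨G, hG⟩ := exists_operator B
    (fun f g x => by
      simp only [B]
      rw [← intervalIntegral.integral_add ((hAc f).intervalIntegrable _ _)
        ((hAc g).intervalIntegrable _ _)]
      simp [hAadd])
    (fun r f x => by simp only [B]; rw [← intervalIntegral.integral_const_mul]; simp [hAsmul])
    (fun f => continuous_iff_continuousAt.2 fun x => (hB f x).continuousAt)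
    (fun f => even_primitive (hAo f))
    (fun f => periodic_primitive (hAc f) (hAp f) (integral_symmetric_of_odd (hAc f) (hAo f)))
    (2 * Real.pi * Real.pi) (fun f x hx => by
      have h := intervalIntegral.norm_integral_le_of_norm_le_const (a := 0) (b := x) (f := A f)
        (C := 2 * ‖f‖ * Real.pi) (fun t ht => hAb' f t (by
          rw [uIoc_of_le hx.1] at ht
          exact ⟨ht.1.le, ht.2.trans hx.2⟩))
      rw [sub_zero, abs_of_nonneg hx.1] at h
      calc |B f x| ≤ _ := h
        _ ≤ 2 * ‖f‖ * Real.pi * Real.pi := by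
          exact mul_le_mul_of_nonneg_left hx.2 (by positivity)
        _ = _ := by ring)
  refine ⟨G, ?_, fun f => ⟨A f, ?_, hA f⟩⟩
  · refine lift_injective (funext fun x => ?_)
    simp [hG, B, A, φ, mean_cosElt]
  · rw [show lift (G f) = B f from funext (hG f)]
    exact hB f

/-- Jordan's inequality on `[0, π / 2]`, reflected in `π / 2`. -/
lemma min_le_sin {x : ℝ} (hx : x ∈ Icc 0 Real.pi) :
    min x (Real.pi - x) ≤ Real.pi / 2 * Real.sin x := by
  have key : ∀ y, 0 ≤ y → y ≤ Real.pi / 2 → y ≤ Real.pi / 2 * Real.sin y := fun y h0 h1 => by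
    have := Real.mul_le_sin h0 h1
    have hp := Real.pi_pos
    calc y = Real.pi / 2 * (2 / Real.pi * y) := by field_simp
      _ ≤ _ := by gcongr
  rcases le_total x (Real.pi / 2) with h | h
  · exact (min_le_left _ _).trans (key x hx.1 h)
  · refine (min_le_right _ _).trans ?_
    have := key (Real.pi - x) (by linarith [hx.2]) (by linarith)
    rwa [Real.sin_pi_sub] at this

/-- The operator that solves `v'' + v = f - (cosCoeff f) cos`. -/
lemma exists_resonantGreen : ∃ S : CosSpace →L[ℝ] CosSpace,
    ∀ f, ∃ D : ℝ → ℝ, (∀ x, HasDerivAt (lift (S f)) (D x) x) ∧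
      (∀ x, HasDerivAt D (lift (removeCos f) x - lift (S f) x) x) ∧
      ∀ x ∈ Icc 0 Real.pi, |D x| ≤ 15 * ‖f‖ * Real.sin x := by
  let φ : CosSpace → ℝ → ℝ := fun f => lift (removeCos f)
  let A : CosSpace → ℝ → ℝ := fun f x => ∫ t in (0 : ℝ)..x, φ f t * Real.cos t
  let B : CosSpace → ℝ → ℝ := fun f x => ∫ t in (0 : ℝ)..x, φ f t * Real.sin t
  have hφc : ∀ f, Continuous (φ f) := fun f => continuous_lift _
  have hc : ∀ f, Continuous fun t => φ f t * Real.cos t := fun f =>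
    (hφc f).mul Real.continuous_cos
  have hs : ∀ f, Continuous fun t => φ f t * Real.sin t := fun f =>
    (hφc f).mul Real.continuous_sin
  have hce : ∀ f, Function.Even fun t => φ f t * Real.cos t := fun f x => by
    simp only [φ, even_lift _ x, Real.cos_neg]
  have hso : ∀ f, Function.Odd fun t => φ f t * Real.sin t := fun f x => by
    simp only [φ, even_lift _ x, Real.sin_neg, mul_neg]
  have h0 : ∀ f, ∫ t in (0 : ℝ)..Real.pi, φ f t * Real.cos t = 0 := fun f => by
    have := cosCoeff_removeCos f
    rw [cosCoeff_apply] at this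
    simpa [Real.pi_ne_zero] using this
  have hA : ∀ f x, HasDerivAt (A f) (φ f x * Real.cos x) x := fun f => hasDerivAt_primitive (hc f)
  have hB : ∀ f x, HasDerivAt (B f) (φ f x * Real.sin x) x := fun f => hasDerivAt_primitive (hs f)
  have hAo : ∀ f, Function.Odd (A f) := fun f => odd_primitive (hce f)
  have hBe : ∀ f, Function.Even (B f) := fun f => even_primitive (hso f)
  have hAp : ∀ f, Function.Periodic (A f) (2 * Real.pi) := fun f =>
    periodic_primitive (hc f) (fun x => by simp only [φ, periodic_lift _ x, Real.cos_add_two_pi])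
      (integral_symmetric_of_even (hc f) (hce f) (h0 f))
  have hBp : ∀ f, Function.Periodic (B f) (2 * Real.pi) := fun f =>
    periodic_primitive (hs f) (fun x => by simp only [φ, periodic_lift _ x, Real.sin_add_two_pi])
      (integral_symmetric_of_odd (hs f) (hso f))
  have hφb : ∀ f x, |φ f x| ≤ 3 * ‖f‖ := fun f x =>
    (abs_lift_le _ x).trans (norm_removeCos_le f)
  have hcb : ∀ f x, |φ f x * Real.cos x| ≤ 3 * ‖f‖ := fun f x => by
    rw [abs_mul]
    exact (mul_le_mul (hφb f x) (Real.abs_cos_le_one x) (abs_nonneg _)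
      (by positivity)).trans_eq (mul_one _)
  have hsb : ∀ f x, |φ f x * Real.sin x| ≤ 3 * ‖f‖ := fun f x => by
    rw [abs_mul]
    exact (mul_le_mul (hφb f x) (Real.abs_sin_le_one x) (abs_nonneg _)
      (by positivity)).trans_eq (mul_one _)
  -- `A f` vanishes at both ends of `[0, π]` because the resonant mode has been removed. This is
  -- what lets `D f` be bounded by a multiple of `sin`, as needed later for the sign of `h'`.
  have hAb : ∀ f, ∀ x ∈ Icc 0 Real.pi, |A f x| ≤ 3 * ‖f‖ * min x (Real.pi - x) := fun f x hx => by
    rw [mul_min_of_nonneg _ _ (by positivity)]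
    refine le_min ?_ ?_
    · have := abs_primitive_le (hcb f) 0 x
      rwa [sub_zero, abs_of_nonneg hx.1] at this
    · have h1 := intervalIntegral.integral_add_adjacent_intervals
        ((hc f).intervalIntegrable (μ := MeasureTheory.volume) 0 x)
        ((hc f).intervalIntegrable x Real.pi)
      rw [h0 f] at h1
      have h2 := abs_primitive_le (hcb f) x Real.pi
      rw [abs_of_nonneg (by linarith [hx.2] : 0 ≤ Real.pi - x)] at h2
      rwa [show A f x = -∫ t in x..Real.pi, φ f t * Real.cos t by
        simp only [A]; linarith, abs_neg]
  have hBb : ∀ f, ∀ x ∈ Icc 0 Real.pi, |B f x| ≤ 3 * ‖f‖ * Real.pi := fun f x hx => by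
    refine (abs_primitive_le (hsb f) 0 x).trans ?_
    rw [sub_zero, abs_of_nonneg hx.1]
    exact mul_le_mul_of_nonneg_left hx.2 (by positivity)
  have hAadd : ∀ f g x, A (f + g) x = A f x + A g x := fun f g x => by
    simp only [A]
    rw [← intervalIntegral.integral_add ((hc f).intervalIntegrable _ _)
      ((hc g).intervalIntegrable _ _)]
    congr 1; funext t; simp only [φ, map_add, lift_add]; ring
  have hAsmul : ∀ (r : ℝ) f x, A (r • f) x = r * A f x := fun r f x => by
    simp only [A]
    rw [← intervalIntegral.integral_const_mul]
    congr 1; funext t; simp only [φ, map_smul, lift_smul]; ring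
  have hBadd : ∀ f g x, B (f + g) x = B f x + B g x := fun f g x => by
    simp only [B]
    rw [← intervalIntegral.integral_add ((hs f).intervalIntegrable _ _)
      ((hs g).intervalIntegrable _ _)]
    congr 1; funext t; simp only [φ, map_add, lift_add]; ring
  have hBsmul : ∀ (r : ℝ) f x, B (r • f) x = r * B f x := fun r f x => by
    simp only [B]
    rw [← intervalIntegral.integral_const_mul]
    congr 1; funext t; simp only [φ, map_smul, lift_smul]; ring
  -- Variation of constants for `v'' + v`; `D` is the derivative of `V`.
  let V : CosSpace → ℝ → ℝ := fun f x => Real.sin x * A f x - Real.cos x * B f x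
  let D : CosSpace → ℝ → ℝ := fun f x => Real.cos x * A f x + Real.sin x * B f x
  have hV : ∀ f x, HasDerivAt (V f) (D f x) x := fun f x => by
    refine (((Real.hasDerivAt_sin x).mul (hA f x)).sub
      ((Real.hasDerivAt_cos x).mul (hB f x))).congr_deriv ?_
    simp only [D]; ring
  have hD : ∀ f x, HasDerivAt (D f) (φ f x - V f x) x := fun f x => by
    refine (((Real.hasDerivAt_cos x).mul (hA f x)).add
      ((Real.hasDerivAt_sin x).mul (hB f x))).congr_deriv ?_
    simp only [V]
    linear_combination (φ f x) * Real.sin_sq_add_cos_sq x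
  have hDb : ∀ f, ∀ x ∈ Icc 0 Real.pi, |D f x| ≤ 15 * ‖f‖ * Real.sin x := fun f x hx => by
    have hsin := Real.sin_nonneg_of_mem_Icc hx
    calc |D f x| ≤ |Real.cos x * A f x| + |Real.sin x * B f x| := abs_add_le _ _
      _ ≤ 1 * (3 * ‖f‖ * (Real.pi / 2 * Real.sin x)) + Real.sin x * (3 * ‖f‖ * Real.pi) := by
        rw [abs_mul, abs_mul, abs_of_nonneg hsin]
        refine add_le_add (mul_le_mul (Real.abs_cos_le_one x) ((hAb f x hx).trans ?_)
          (abs_nonneg _) zero_le_one) (mul_le_mul_of_nonneg_left (hBb f x hx) hsin)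
        exact mul_le_mul_of_nonneg_left (min_le_sin hx) (by positivity)
      _ = (9 / 2 * Real.pi) * (‖f‖ * Real.sin x) := by ring
      -- `9 π / 2 < 15`.
      _ ≤ 15 * (‖f‖ * Real.sin x) := by
        gcongr
        linarith [Real.pi_lt_d2]
      _ = _ := by ring
  obtain ⟨S, hS⟩ := exists_operator V
    (fun f g x => by simp only [V, hAadd, hBadd]; ring)
    (fun r f x => by simp only [V, hAsmul, hBsmul]; ring)
    (fun f => continuous_iff_continuousAt.2 fun x => (hV f x).continuousAt)
    (fun f x => by simp only [V, hAo f x, hBe f x, Real.sin_neg, Real.cos_neg]; ring)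
    (fun f x => by simp only [V, hAp f x, hBp f x, Real.sin_add_two_pi, Real.cos_add_two_pi])
    (6 * Real.pi) (fun f x hx => by
      calc |V f x| ≤ |Real.sin x * A f x| + |Real.cos x * B f x| := abs_sub _ _
        _ ≤ 1 * (3 * ‖f‖ * Real.pi) + 1 * (3 * ‖f‖ * Real.pi) := by
          rw [abs_mul, abs_mul]
          refine add_le_add (mul_le_mul (Real.abs_sin_le_one x) ((hAb f x hx).trans ?_)
            (abs_nonneg _) zero_le_one) (mul_le_mul (Real.abs_cos_le_one x) (hBb f x hx)
            (abs_nonneg _) zero_le_one)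
          exact mul_le_mul_of_nonneg_left ((min_le_left _ _).trans hx.2) (by positivity)
        _ = _ := by ring)
  refine ⟨S, fun f => ⟨D f, ?_, ?_, hDb f⟩⟩
  · rw [show lift (S f) = V f from funext (hS f)]
    exact hV f
  · intro x
    rw [hS]
    exact hD f x

/-! ### The bifurcation equation -/

section ProfileMap

variable (G S : CosSpace →L[ℝ] CosSpace)

/-- With `p = (δ, f, e)`, the perturbation `z` in the radius of curvature `1 + δ z`. -/
noncomputable def radiusPert (p : ℝ × CosSpace × ℝ) : CosSpace :=
  -- Put `c = cosCoeff f` and `h = -(c/δ) cos + 1 + δ S f`. In `h + (1 + δ²) h''` the cosine term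
  -- leaves `δ c cos`, which restores the mode missing from `δ removeCos f`; the sum is `1 + δ z`
  -- with this `z`.
  p.2.1 + p.1 ^ 2 • (removeCos p.2.1 - S p.2.1)

/-- The radius of curvature `1 + δ z`. -/
noncomputable def radius (p : ℝ × CosSpace × ℝ) : CosSpace := 1 + p.1 • radiusPert S p

/-- The support function, multiplied by `δ`. -/
noncomputable def scaledSupport (p : ℝ × CosSpace × ℝ) : CosSpace :=
  (-cosCoeff p.2.1) • cosElt + p.1 • 1 + p.1 ^ 2 • S p.2.1

/-- The desingularised shrinker equation for the unknowns `(f, e)` with parameter `δ`, augmented by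
the parameter itself. -/
noncomputable def profileMap (p : ℝ × CosSpace × ℝ) : ℝ × CosSpace × ℝ :=
  (p.1,
    -- With `H = δ h` and `W = 1 + δ z`, this is `δ⁻¹` times `(1 + δ²)(W² - 1) - 2 e δ G(H W) W²`,
    -- the twice integrated equation for `W⁻²`. The last component is `δ⁻¹ mean (H W)`, whose
    -- vanishing is the solvability condition for that integration.
    (1 + p.1 ^ 2) • ((2 : ℝ) • radiusPert S p + p.1 • radiusPert S p ^ 2) -
      (2 * p.2.2) • (G (scaledSupport S p * radius S p) * radius S p ^ 2),
    mean (1 + p.1 • S p.2.1 + scaledSupport S p * radiusPert S p))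

/-- The solution of the equation at `δ = 0`. -/
noncomputable def basePoint : ℝ × CosSpace × ℝ := (0, √2 • (1 - cosElt), 1)

lemma contDiff_radiusPert : ContDiff ℝ ∞ (radiusPert S) := by
  unfold radiusPert; fun_prop

lemma contDiff_radius : ContDiff ℝ ∞ (radius S) := by
  have := contDiff_radiusPert S
  unfold radius; fun_prop

lemma contDiff_scaledSupport : ContDiff ℝ ∞ (scaledSupport S) := by
  unfold scaledSupport; fun_prop

lemma contDiff_profileMap : ContDiff ℝ ∞ (profileMap G S) := by
  have := contDiff_radiusPert S
  have := contDiff_radius S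
  have := contDiff_scaledSupport S
  unfold profileMap; fun_prop

variable {G}

lemma profileMap_zero (hG : G cosElt = 1 - cosElt) (f : CosSpace) (e : ℝ) :
    profileMap G S (0, f, e) =
      (0, (2 : ℝ) • f + (2 * e * cosCoeff f) • (1 - cosElt), 1 - cosCoeff f ^ 2 / 2) := by
  have h1 : radiusPert S (0, f, e) = f := by simp [radiusPert]
  have h2 : radius S (0, f, e) = 1 := by simp [radius]
  have h3 : scaledSupport S (0, f, e) = (-cosCoeff f) • cosElt := by simp [scaledSupport]
  simp only [profileMap, h1, h2, h3, Prod.mk.injEq, true_and]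
  constructor
  · simp only [mul_one, one_pow, map_smul, hG]
    module
  · simp only [zero_smul, add_zero, map_add, mean_one, smul_mul_assoc, map_smul,
      mean_cosElt_mul, smul_eq_mul]
    ring

lemma cosCoeff_basePoint : cosCoeff basePoint.2.1 = -√2 := by
  simp [basePoint, cosCoeff_one, cosCoeff_cosElt]

lemma profileMap_basePoint (hG : G cosElt = 1 - cosElt) : profileMap G S basePoint = 0 := by
  have h := profileMap_zero S hG basePoint.2.1 basePoint.2.2
  rw [cosCoeff_basePoint] at h
  refine (show profileMap G S basePoint = _ from h).trans ?_
  simp only [basePoint, Prod.mk_eq_zero, true_and]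
  constructor
  · module
  · norm_num

/-- The first component is the identity in `δ`, so only the directions `(0, g, b)` need be inverted.
On the slice `δ = 0` the map is explicit by `profileMap_zero`, and its derivative there is a
rank-one perturbation of `2 • g`, bordered by scalar terms. -/
lemma range_fderiv_profileMap (hG : G cosElt = 1 - cosElt) :
    (fderiv ℝ (profileMap G S) basePoint).range = ⊤ := by
  set D := fderiv ℝ (profileMap G S) basePoint
  have hΦ : HasFDerivAt (profileMap G S) D basePoint :=
    ((contDiff_profileMap G S).differentiable (by simp) _).hasFDerivAt
  have hfst : ∀ v, (D v).1 = v.1 := fun v => by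
    have h1 : HasFDerivAt (fun p => (profileMap G S p).1) ((ContinuousLinearMap.fst ℝ _ _).comp D)
      basePoint := hΦ.fst
    have h2 : HasFDerivAt (fun p : ℝ × CosSpace × ℝ => p.1) (ContinuousLinearMap.fst ℝ _ _)
      basePoint := hasFDerivAt_fst
    exact congrArg (fun L : (ℝ × CosSpace × ℝ) →L[ℝ] ℝ => L v) (h1.unique h2)
  have hdir : ∀ (g : CosSpace) (b : ℝ), D (0, g, b) =
      (0, (2 : ℝ) • g + (2 * (cosCoeff g - b * √2)) • (1 - cosElt), √2 * cosCoeff g) :=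
      fun g b => by
    have h1 : HasDerivAt (fun t : ℝ => basePoint + t • ((0, g, b) : ℝ × CosSpace × ℝ))
        (0, g, b) 0 := by
      simpa using ((hasDerivAt_id (0 : ℝ)).smul_const ((0, g, b) : ℝ × CosSpace × ℝ)).const_add
        basePoint
    have h2 := HasFDerivAt.comp_hasDerivAt (l := profileMap G S) (l' := D) (0 : ℝ)
      (by simpa using hΦ) h1
    have h3 : (profileMap G S ∘ fun t : ℝ => basePoint + t • ((0, g, b) : ℝ × CosSpace × ℝ)) =
        fun t : ℝ => ((0 : ℝ), (2 : ℝ) • (basePoint.2.1 + t • g) +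
          (2 * (1 + t * b) * (-√2 + t * cosCoeff g)) • (1 - cosElt),
          1 - (-√2 + t * cosCoeff g) ^ 2 / 2) := by
      funext t
      have := profileMap_zero S hG (basePoint.2.1 + t • g) (1 + t * b)
      rw [map_add, map_smul, cosCoeff_basePoint, smul_eq_mul] at this
      rw [← this]
      simp [basePoint]
    rw [h3] at h2
    have h4 : HasDerivAt (fun t : ℝ => -√2 + t * cosCoeff g) (cosCoeff g) 0 := by
      simpa using ((hasDerivAt_id (0 : ℝ)).mul_const (cosCoeff g)).const_add (-√2)
    have h5 : HasDerivAt (fun t : ℝ => 2 * (1 + t * b)) (2 * b) 0 := by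
      simpa using (((hasDerivAt_id (0 : ℝ)).mul_const b).const_add 1).const_mul 2
    have h6 : HasDerivAt (fun t : ℝ => (2 : ℝ) • (basePoint.2.1 + t • g)) ((2 : ℝ) • g) 0 := by
      have := (((hasDerivAt_id (0 : ℝ)).smul_const g).const_add basePoint.2.1).const_smul (2 : ℝ)
      rw [one_smul] at this
      exact this
    have h7 := (hasDerivAt_const (0 : ℝ) (0 : ℝ)).prodMk
      ((h6.add ((h5.mul h4).smul_const (1 - cosElt))).prodMk
        (((h4.pow 2).div_const 2).const_sub 1))
    rw [h2.unique h7]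
    simp only [Prod.mk.injEq, true_and]
    constructor
    · congr 2
      ring
    · push_cast
      ring
  rw [LinearMap.range_eq_top]
  rintro ⟨s, g, r⟩
  obtain ⟨g', r', h'⟩ : ∃ g' r', D (s, 0, 0) = (s, g', r') :=
    ⟨(D (s, 0, 0)).2.1, (D (s, 0, 0)).2.2, Prod.ext (hfst _) rfl⟩
  have hs0 : √2 ≠ 0 := by positivity
  -- The scalar equation gives `cosCoeff k = c`; applying `cosCoeff` to the function equation then
  -- determines `b`, and `k` follows.
  set c := (r - r') / √2
  set b := (cosCoeff (g - g')) / (2 * √2)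
  set k : CosSpace := (1 / 2 : ℝ) • (g - g') - (c - b * √2) • (1 - cosElt)
  have hbm : b * √2 = cosCoeff (g - g') / 2 := by simp only [b]; field_simp
  have hk : cosCoeff k = c := by
    simp only [k]
    rw [map_sub, map_smul, map_smul, map_sub cosCoeff 1, cosCoeff_one, cosCoeff_cosElt,
      smul_eq_mul, smul_eq_mul, hbm]
    ring
  refine ⟨(s, k, b), ?_⟩
  have : ((s, k, b) : ℝ × CosSpace × ℝ) = (s, 0, 0) + (0, k, b) := by simp
  change D _ = _
  rw [this, map_add, h', hdir, hk]
  simp only [Prod.mk_add_mk, add_zero, Prod.mk.injEq, true_and]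
  constructor
  · simp only [k]
    module
  · simp only [c]
    field_simp
    ring

/-- A surjective strict derivative maps neighbourhoods onto neighbourhoods; carrying `δ` as a
component lets each small value be prescribed. -/
lemma eventually_exists_solution (hG : G cosElt = 1 - cosElt) {U : Set (ℝ × CosSpace × ℝ)}
    (hU : U ∈ 𝓝 basePoint) :
    ∀ᶠ δ in 𝓝 (0 : ℝ), ∃ f e, (δ, f, e) ∈ U ∧ profileMap G S (δ, f, e) = (δ, 0, 0) := by
  have hstrict : HasStrictFDerivAt (profileMap G S) (fderiv ℝ (profileMap G S) basePoint)
      basePoint := (contDiff_profileMap G S).contDiffAt.hasStrictFDerivAt (by simp)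
  have hmap := hstrict.map_nhds_eq_of_surj (range_fderiv_profileMap S hG)
  rw [profileMap_basePoint S hG] at hmap
  have hmem : profileMap G S '' U ∈ 𝓝 (0 : ℝ × CosSpace × ℝ) := hmap ▸ image_mem_map hU
  have ht : Tendsto (fun δ : ℝ => (δ, (0 : CosSpace), (0 : ℝ))) (𝓝 0) (𝓝 0) :=
    Continuous.tendsto' (by fun_prop) _ _ rfl
  filter_upwards [ht hmem] with δ hδ
  obtain ⟨⟨δ', f, e⟩, hp, hpe⟩ := hδ
  obtain rfl : δ' = δ := congrArg Prod.fst hpe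
  exact ⟨f, e, hp, hpe⟩

end ProfileMap

/-! ### Profiles -/

/-- `h`, as a function of `x = θ / l` with `θ` the tangent angle, is the support function of an
epicyclic shrinker with radius of curvature `w`. -/
structure IsShrinkerProfile (l ε : ℝ) (h w : ℝ → ℝ) : Prop where
  smooth : ContDiff ℝ ∞ h
  smooth_radius : ContDiff ℝ ∞ w
  even : Function.Even h
  periodic : Function.Periodic h (2 * Real.pi)
  radius_eq : ∀ x, w x = h x + l ^ 2 * deriv (deriv h) x
  radius_pos : ∀ x, 0 < w x
  shrinker_eq : ∀ x, l ^ 2 * deriv (deriv fun x => (w x ^ 2)⁻¹) x = -2 * ε * h x * w x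
  deriv_neg : ∀ x ∈ Ioo 0 Real.pi, deriv h x < 0

lemma contDiff_add_two_of_hasDerivAt {n : ℕ} {v v₁ v₂ : ℝ → ℝ} (h₁ : ∀ x, HasDerivAt v (v₁ x) x)
    (h₂ : ∀ x, HasDerivAt v₁ (v₂ x) x) (hv : ContDiff ℝ n v₂) : ContDiff ℝ (n + 2 : ℕ) v := by
  have step : ∀ {k : ℕ} {a b : ℝ → ℝ}, (∀ x, HasDerivAt a (b x) x) → ContDiff ℝ k b →
      ContDiff ℝ (k + 1 : ℕ) a := fun {k a b} ha hb => by
    rw [Nat.cast_add, Nat.cast_one, contDiff_succ_iff_deriv]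
    refine ⟨fun x => (ha x).differentiableAt, by simp, ?_⟩
    rwa [show deriv a = b from funext fun x => (ha x).deriv]
  exact step h₁ (step h₂ hv)

/-- Bootstrapping for the system satisfied by the support function and the radius of curvature. -/
lemma contDiff_of_system {l c : ℝ} (hl : l ≠ 0) {h h₁ h₂ w y y₁ y₂ : ℝ → ℝ}
    (hh : ∀ x, HasDerivAt h (h₁ x) x) (hh₁ : ∀ x, HasDerivAt h₁ (h₂ x) x)
    (hy : ∀ x, HasDerivAt y (y₁ x) x) (hy₁ : ∀ x, HasDerivAt y₁ (y₂ x) x)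
    (hw : ∀ x, w x = h x + l ^ 2 * h₂ x) (hpos : ∀ x, 0 < w x) (hyw : ∀ x, y x * w x ^ 2 = 1)
    (hy₂ : ∀ x, y₂ x = c * (h x * w x)) : ContDiff ℝ ∞ h ∧ ContDiff ℝ ∞ w := by
  have hy0 : ∀ x, 0 < y x := fun x => by
    have := hpos x
    by_contra! hneg
    have := hyw x
    nlinarith [sq_nonneg (w x)]
  have hwy : w = fun x => √((y x)⁻¹) := by
    funext x
    rw [inv_eq_of_mul_eq_one_right (hyw x), Real.sqrt_sq (hpos x).le]
  have hh₂ : h₂ = fun x => (w x - h x) / l ^ 2 := by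
    funext x; rw [hw x]; field_simp; ring
  have hfromy : ∀ n : ℕ, ContDiff ℝ n y → ContDiff ℝ n w := fun n hn => by
    rw [hwy]
    exact (hn.inv fun x => (hy0 x).ne').sqrt fun x => (inv_pos.2 (hy0 x)).ne'
  have key : ∀ n : ℕ, ContDiff ℝ n h ∧ ContDiff ℝ n w := fun n => by
    induction n with
    | zero =>
      refine ⟨?_, hfromy 0 ?_⟩
      all_goals simp only [Nat.cast_zero, contDiff_zero]
      · exact continuous_iff_continuousAt.2 fun x => (hh x).continuousAt
      · exact continuous_iff_continuousAt.2 fun x => (hy x).continuousAt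
    -- From `h'' = (w - h) / l²`, `y'' = c h w` and `w = y^(-1/2)`, each pass gains two derivatives,
    -- of which one is used.
    | succ n ih =>
      obtain ⟨ih₁, ih₂⟩ := ih
      have h1 : ContDiff ℝ (n + 2 : ℕ) h := contDiff_add_two_of_hasDerivAt hh hh₁ (by
        rw [hh₂]; exact (ih₂.sub ih₁).div_const _)
      have h2 : ContDiff ℝ (n + 2 : ℕ) y := contDiff_add_two_of_hasDerivAt hy hy₁ (by
        rw [show y₂ = fun x => c * (h x * w x) from funext hy₂]
        exact contDiff_const.mul (ih₁.mul ih₂))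
      have hle : ((n + 1 : ℕ) : WithTop ℕ∞) ≤ ((n + 2 : ℕ) : WithTop ℕ∞) := by
        exact_mod_cast Nat.le_succ _
      exact ⟨h1.of_le hle, (hfromy _ h2).of_le hle⟩
  exact ⟨contDiff_infty.2 fun n => (key n).1, contDiff_infty.2 fun n => (key n).2⟩

/-- Existence of profiles close to the resonance `l = 1`. -/
lemma eventually_exists_profile : ∀ᶠ δ in 𝓝[>] (0 : ℝ), ∀ l : ℝ, l ^ 2 = 1 + δ ^ 2 →
    ∃ (ε : ℝ) (h w : ℝ → ℝ), 0 < ε ∧ IsShrinkerProfile l ε h w := by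
  obtain ⟨G, hG, hGd⟩ := exists_doublePrimitive
  obtain ⟨S, hSd⟩ := exists_resonantGreen
  have hcr := (contDiff_radiusPert S).continuous
  -- Three open conditions at the base point: they yield `ε > 0`, `h' < 0` on `(0, π)`, and `w > 0`
  -- respectively.
  have hU : {p : ℝ × CosSpace × ℝ | 0 < p.2.2 ∧ p.1 ^ 2 * (15 * ‖p.2.1‖) < -cosCoeff p.2.1 ∧
      |p.1| * ‖radiusPert S p‖ < 1} ∈ 𝓝 basePoint := by
    refine IsOpen.mem_nhds ?_ ?_
    · simp only [ofPred_and]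
      exact (isOpen_lt (by fun_prop) (by fun_prop)).inter
        ((isOpen_lt (by fun_prop) (by fun_prop)).inter (isOpen_lt (by fun_prop) (by fun_prop)))
    · refine ⟨by simp [basePoint], ?_, by simp [basePoint]⟩
      rw [cosCoeff_basePoint]
      simp [basePoint]
  filter_upwards [(eventually_exists_solution S hG hU).filter_mono nhdsWithin_le_nhds,
    self_mem_nhdsWithin] with δ hδ hpos l hl
  replace hpos : 0 < δ := hpos
  obtain ⟨f, e, ⟨he, hf, hz⟩, hsol⟩ := hδ
  obtain ⟨D, hSf, hDf, hDb⟩ := hSd f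
  set z := radiusPert S (δ, f, e) with hzdef
  set W := radius S (δ, f, e) with hWdef
  set H := scaledSupport S (δ, f, e) with hHdef
  obtain ⟨A, hGf, hAf⟩ := hGd (H * W)
  simp only [profileMap, ← hzdef, ← hWdef, ← hHdef, Prod.mk.injEq, true_and] at hsol
  obtain ⟨hsol1, hsol2⟩ := hsol
  have hl0 : l ≠ 0 := by
    rintro rfl
    nlinarith
  have hWz : W = 1 + δ • z := rfl
  have hH : H = (-cosCoeff f) • cosElt + δ • 1 + δ ^ 2 • S f := rfl
  have hzf : z = f + δ ^ 2 • (removeCos f - S f) := rfl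
  have hmean : mean (H * W) = 0 := by
    have : H * W = (-cosCoeff f) • cosElt + δ • (1 + δ • S f + H * z) := by
      refine lift_injective (funext fun x => ?_)
      rw [hWz]
      simp only [lift_mul, lift_add, lift_smul, lift_one]
      rw [hH]
      simp only [lift_add, lift_smul, lift_one]
      ring
    rw [this, map_add, map_smul, map_smul, hsol2, mean_cosElt]
    simp
  set a := -cosCoeff f with ha
  have ha0 : 0 < a := lt_of_le_of_lt (by positivity) hf
  let h : ℝ → ℝ := fun x => a / δ * Real.cos x + 1 + δ * lift (S f) x
  let h₁ : ℝ → ℝ := fun x => -(a / δ) * Real.sin x + δ * D x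
  let h₂ : ℝ → ℝ := fun x => -(a / δ) * Real.cos x + δ * (lift (removeCos f) x - lift (S f) x)
  -- The candidate for `w⁻²`; `hyw` below recovers this from the second component of `profileMap`.
  let y : ℝ → ℝ := fun x => 1 + -(2 * e * δ / (1 + δ ^ 2)) * lift (G (H * W)) x
  let y₁ : ℝ → ℝ := fun x => -(2 * e * δ / (1 + δ ^ 2)) * A x
  let y₂ : ℝ → ℝ := fun x => -(2 * e * δ / (1 + δ ^ 2)) * lift (H * W) x
  have hh : ∀ x, HasDerivAt h (h₁ x) x := fun x => by
    refine ((((Real.hasDerivAt_cos x).const_mul (a / δ)).add_const 1).add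
      ((hSf x).const_mul δ)).congr_deriv ?_
    simp only [h₁]; ring
  have hh₁ : ∀ x, HasDerivAt h₁ (h₂ x) x := fun x =>
    ((Real.hasDerivAt_sin x).const_mul (-(a / δ))).add ((hDf x).const_mul δ)
  have hy : ∀ x, HasDerivAt y (y₁ x) x := fun x => ((hGf x).const_mul _).const_add 1
  have hy₁ : ∀ x, HasDerivAt y₁ (y₂ x) x := fun x => by
    have := hAf x
    rw [hmean, sub_zero] at this
    exact this.const_mul _
  have hHx : ∀ x, lift H x = δ * h x := fun x => by
    simp only [hH, h, lift_add, lift_smul, lift_cosElt, lift_one]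
    field_simp
  have hw : ∀ x, lift W x = h x + l ^ 2 * h₂ x := fun x => by
    simp only [hWz, hzf, h, h₂, hl, removeCos_apply, lift_add, lift_sub, lift_smul, lift_cosElt,
      lift_one]
    rw [show cosCoeff f = -a by simp [ha]]
    field_simp
    ring
  have hWpos : ∀ x, 0 < lift W x := fun x => by
    have h1 : |δ * lift z x| < 1 := by
      rw [abs_mul]
      exact lt_of_le_of_lt (mul_le_mul_of_nonneg_left (abs_lift_le z x) (abs_nonneg _)) hz
    have := (abs_lt.1 h1).1
    simp only [hWz, lift_add, lift_smul, lift_one]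
    linarith
  have hyw : ∀ x, y x * lift W x ^ 2 = 1 := fun x => by
    have h1 := congrArg (fun g => lift g x) hsol1
    simp only [lift_sub, lift_smul, lift_add, lift_mul, lift_pow, lift_zero] at h1
    have h2 : lift W x = 1 + δ * lift z x := by simp [hWz]
    simp only [y]
    have h3 : (1 + δ ^ 2) ≠ 0 := by positivity
    field_simp
    rw [h2] at h1 ⊢
    linear_combination δ * h1
  have hy₂ : ∀ x, y₂ x = -(2 * e * δ ^ 2 / (1 + δ ^ 2)) * (h x * lift W x) := fun x => by
    simp only [y₂, lift_mul, hHx]; ring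
  obtain ⟨hsm, hwsm⟩ := contDiff_of_system hl0 hh hh₁ hy hy₁ hw hWpos hyw hy₂
  have hdh : deriv h = h₁ := funext fun x => (hh x).deriv
  refine ⟨e * δ ^ 2, h, lift W, by positivity, hsm, hwsm, ?_, ?_, ?_, hWpos, ?_, ?_⟩
  · intro x
    simp only [h, Real.cos_neg, even_lift (S f) x]
  · intro x
    simp only [h, Real.cos_add_two_pi, periodic_lift (S f) x]
  · intro x
    rw [hw, hdh, (hh₁ x).deriv]
  · intro x
    have hyeq : (fun x => (lift W x ^ 2)⁻¹) = y := funext fun x => by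
      exact inv_eq_of_mul_eq_one_left (hyw x)
    rw [hyeq, show deriv y = y₁ from funext fun x => (hy x).deriv, (hy₁ x).deriv, hy₂, hl]
    field_simp
  · intro x hx
    have hsin := Real.sin_pos_of_mem_Ioo hx
    have h1 := (abs_le.1 (hDb x (Ioo_subset_Icc_self hx))).2
    rw [hdh]
    have h2 : δ * D x < a / δ * Real.sin x := by
      calc δ * D x ≤ δ * (15 * ‖f‖ * Real.sin x) := by gcongr
        _ = (δ ^ 2 * (15 * ‖f‖)) / δ * Real.sin x := by field_simp
        _ < _ := by gcongr
    simp only [h₁]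
    linarith

/-! ### The curve with a given support function -/

/-- The unit complex number with angle `(m - 1) u`. -/
noncomputable def phase (m : ℕ) (u : ℝ) : ℂ := Complex.exp ((((m : ℝ) - 1) * u : ℝ) * Complex.I)

/-- The curve with tangent angle `(m - 1) u` and support function `u ↦ h (m u)`. -/
noncomputable def epicycle (m : ℕ) (h : ℝ → ℝ) (u : ℝ) : ℂ :=
  (((m / (m - 1) * deriv h (m * u) : ℝ) : ℂ) - (h (m * u) : ℝ) * Complex.I) * phase m u

lemma norm_phase (m : ℕ) (u : ℝ) : ‖phase m u‖ = 1 := Complex.norm_exp_ofReal_mul_I _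

lemma phase_add (m : ℕ) (u v : ℝ) : phase m (u + v) = phase m u * phase m v := by
  rw [phase, phase, phase, ← Complex.exp_add]
  push_cast
  ring_nf

lemma phase_two_pi (m : ℕ) : phase m (2 * Real.pi) = 1 := by
  rw [phase]
  have := Complex.exp_int_mul_two_pi_mul_I ((m : ℤ) - 1)
  rw [← this]
  push_cast
  ring_nf

lemma hasDerivAt_phase (m : ℕ) (u : ℝ) :
    HasDerivAt (phase m) (((m : ℝ) - 1 : ℝ) * Complex.I * phase m u) u := by
  have h1 : HasDerivAt (fun u : ℝ => ((((m : ℝ) - 1) * u : ℝ) : ℂ) * Complex.I)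
      (((m : ℝ) - 1 : ℝ) * Complex.I) u := by
    have := (((hasDerivAt_id u).const_mul ((m : ℝ) - 1)).ofReal_comp).mul_const Complex.I
    simpa using this
  refine h1.cexp.congr_deriv ?_
  rw [phase]; ring

lemma contDiff_phase (m : ℕ) : ContDiff ℝ ∞ (phase m) := by
  have : ContDiff ℝ ∞ (fun u : ℝ => ((((m : ℝ) - 1) * u : ℝ) : ℂ)) :=
    Complex.ofRealCLM.contDiff.comp (contDiff_const.mul contDiff_id)
  exact (this.mul contDiff_const).cexp

lemma inner_mul_phase (m : ℕ) (u : ℝ) (z v : ℂ) :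
    inner ℝ (z * phase m u) (v * phase m u) = inner ℝ z v := by
  have hn : phase m u * (starRingEnd ℂ) (phase m u) = 1 := by
    rw [Complex.mul_conj, Complex.normSq_eq_norm_sq, norm_phase]; simp
  rw [Complex.inner, Complex.inner, map_mul,
    show v * phase m u * ((starRingEnd ℂ) z * (starRingEnd ℂ) (phase m u)) =
      v * (starRingEnd ℂ) z * (phase m u * (starRingEnd ℂ) (phase m u)) by ring, hn, mul_one]

section Geometry

variable {m : ℕ} {ε : ℝ} {h w : ℝ → ℝ}

lemma hasDerivAt_comp_nat_mul {g : ℝ → ℝ} (hg : Differentiable ℝ g) (m : ℕ) (u : ℝ) :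
    HasDerivAt (fun u => g (m * u)) (m * deriv g (m * u)) u := by
  have := (hg (m * u)).hasDerivAt.comp u ((hasDerivAt_id u).const_mul (m : ℝ))
  rw [mul_one, mul_comm] at this
  exact this

lemma cast_sub_one_pos (hm : 2 ≤ m) : (0 : ℝ) < (m : ℝ) - 1 := by
  have : (2 : ℝ) ≤ m := by exact_mod_cast hm
  linarith

lemma IsShrinkerProfile.contDiff_deriv {l : ℝ} (H : IsShrinkerProfile l ε h w) :
    ContDiff ℝ ∞ (deriv h) := ((contDiff_infty_iff_deriv.1 H.smooth).2)

/-- From `τ_θ = ν` and `ν_θ = -τ`, `(h_θ τ - h ν)_θ = (h + h_θθ) τ = w τ`, and `dθ = (m - 1) du`. -/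
lemma hasDerivAt_epicycle (hm : 2 ≤ m) (H : IsShrinkerProfile (m / (m - 1)) ε h w) (u : ℝ) :
    HasDerivAt (epicycle m h) ((((m : ℝ) - 1) * w (m * u) : ℝ) * phase m u) u := by
  have h1 := hasDerivAt_comp_nat_mul (H.smooth.differentiable (by simp)) m u
  have h2 := hasDerivAt_comp_nat_mul (H.contDiff_deriv.differentiable (by simp)) m u
  have hm0 := (cast_sub_one_pos hm).ne'
  refine ((((h2.const_mul (m / (m - 1) : ℝ)).ofReal_comp).sub
    (h1.ofReal_comp.mul_const Complex.I)).mul (hasDerivAt_phase m u)).congr_deriv ?_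
  rw [H.radius_eq]
  have hc : (m : ℂ) - 1 ≠ 0 := by exact_mod_cast hm0
  simp only [Pi.sub_apply]
  push_cast
  field_simp
  linear_combination (-phase m u * (m - 1) ^ 2 * h (m * u)) * Complex.I_sq

lemma deriv_epicycle (hm : 2 ≤ m) (H : IsShrinkerProfile (m / (m - 1)) ε h w) (u : ℝ) :
    deriv (epicycle m h) u = (((m : ℝ) - 1) * w (m * u) : ℝ) * phase m u :=
  (hasDerivAt_epicycle hm H u).deriv

lemma norm_deriv_epicycle (hm : 2 ≤ m) (H : IsShrinkerProfile (m / (m - 1)) ε h w) (u : ℝ) :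
    ‖deriv (epicycle m h) u‖ = ((m : ℝ) - 1) * w (m * u) := by
  rw [deriv_epicycle hm H, norm_mul, norm_phase, mul_one, Complex.norm_real, Real.norm_eq_abs,
    abs_of_pos (mul_pos (cast_sub_one_pos hm) (H.radius_pos _))]

lemma periodic_deriv {g : ℝ → ℝ} {T : ℝ} (hg : Function.Periodic g T) :
    Function.Periodic (deriv g) T := fun x => by
  rw [← deriv_comp_add_const, show (fun x => g (x + T)) = g from funext hg]

lemma isSmoothClosedCurve_epicycle (hm : 2 ≤ m) (H : IsShrinkerProfile (m / (m - 1)) ε h w) :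
    IsSmoothClosedCurve (epicycle m h) where
  smooth := by
    have h1 : ContDiff ℝ ∞ fun u : ℝ => ((m / (m - 1) * deriv h (m * u) : ℝ) : ℂ) :=
      Complex.ofRealCLM.contDiff.comp
        (contDiff_const.mul (H.contDiff_deriv.comp (contDiff_const.mul contDiff_id)))
    have h2 : ContDiff ℝ ∞ fun u : ℝ => ((h (m * u) : ℝ) : ℂ) :=
      Complex.ofRealCLM.contDiff.comp (H.smooth.comp (contDiff_const.mul contDiff_id))
    exact (h1.sub (h2.mul contDiff_const)).mul (contDiff_phase m)
  periodic := fun u => by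
    rw [epicycle, epicycle, phase_add, phase_two_pi, mul_one, mul_add,
      H.periodic.nat_mul m, (periodic_deriv H.periodic).nat_mul m]
  immersed := fun u => by
    rw [← norm_ne_zero_iff, norm_deriv_epicycle hm H]
    exact (mul_pos (cast_sub_one_pos hm) (H.radius_pos _)).ne'

lemma unitTangent_epicycle (hm : 2 ≤ m) (H : IsShrinkerProfile (m / (m - 1)) ε h w) :
    unitTangent (epicycle m h) = phase m := funext fun u => by
  have h0 := (mul_pos (cast_sub_one_pos hm) (H.radius_pos (m * u))).ne'
  rw [unitTangent, arcDeriv, norm_deriv_epicycle hm H, deriv_epicycle hm H, Complex.real_smul,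
    ← mul_assoc, ← Complex.ofReal_mul, inv_mul_cancel₀ h0, Complex.ofReal_one, one_mul]

lemma unitNormal_epicycle (hm : 2 ≤ m) (H : IsShrinkerProfile (m / (m - 1)) ε h w) (u : ℝ) :
    unitNormal (epicycle m h) u = Complex.I * phase m u := by
  rw [unitNormal, unitTangent_epicycle hm H]

lemma curvature_epicycle (hm : 2 ≤ m) (H : IsShrinkerProfile (m / (m - 1)) ε h w) :
    curvature (epicycle m h) = fun u => (w (m * u))⁻¹ := funext fun u => by
  have h0 := (cast_sub_one_pos hm).ne'
  have h1 := (H.radius_pos (m * u)).ne'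
  have h2 : arcDeriv (epicycle m h) (phase m) u =
      ((w (m * u))⁻¹ : ℝ) * Complex.I * phase m u := by
    rw [arcDeriv, norm_deriv_epicycle hm H, (hasDerivAt_phase m u).deriv, Complex.real_smul,
      ← mul_assoc, ← mul_assoc, ← Complex.ofReal_mul]
    congr 3
    field_simp
  rw [curvature, unitTangent_epicycle hm H, unitNormal_epicycle hm H, h2, inner_mul_phase,
    Complex.inner]
  simp

lemma inner_epicycle_unitNormal (hm : 2 ≤ m) (H : IsShrinkerProfile (m / (m - 1)) ε h w) (u : ℝ) :
    inner ℝ (epicycle m h u) (unitNormal (epicycle m h) u) = -h (m * u) := by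
  rw [unitNormal_epicycle hm H, epicycle, inner_mul_phase, Complex.inner]
  simp [-Complex.ofReal_mul, -Complex.ofReal_div]

lemma curvatureSS_epicycle (hm : 2 ≤ m) (H : IsShrinkerProfile (m / (m - 1)) ε h w) (u : ℝ) :
    curvatureSS (epicycle m h) u = -ε * h (m * u) := by
  have h0 := (cast_sub_one_pos hm).ne'
  have hw0 : ∀ x, w x ≠ 0 := fun x => (H.radius_pos x).ne'
  have hwd : Differentiable ℝ w := H.smooth_radius.differentiable (by simp)
  set Y : ℝ → ℝ := fun x => (w x ^ 2)⁻¹ with hY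
  have hYs : ContDiff ℝ ∞ Y := (H.smooth_radius.pow 2).inv fun x => pow_ne_zero 2 (hw0 x)
  have hYd : ∀ x, deriv Y x = -2 * deriv w x / w x ^ 3 := fun x => by
    have := (((hwd x).hasDerivAt.pow 2).inv (pow_ne_zero 2 (hw0 x))).deriv
    rw [show Y = (w ^ 2)⁻¹ from rfl, this]
    have := hw0 x
    simp only [Pi.pow_apply]
    field_simp
    norm_num
    ring
  -- `kₛ = k k_θ = (k²)_θ / 2`, which is why the profile equation is written for `Y = w⁻²`.
  have hS : arcDeriv (epicycle m h) (curvature (epicycle m h)) =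
      fun u => (m / (m - 1) / 2) * deriv Y (m * u) := funext fun u => by
    have h1 := (hasDerivAt_comp_nat_mul hwd m u).inv (hw0 _)
    have h2 : (fun u : ℝ => (w (m * u))⁻¹) = (fun u : ℝ => w (m * u))⁻¹ := rfl
    rw [arcDeriv, norm_deriv_epicycle hm H, curvature_epicycle hm H, h2, h1.deriv, hYd, smul_eq_mul]
    have := hw0 (m * u)
    field_simp
  have hYY := hasDerivAt_comp_nat_mul ((contDiff_infty_iff_deriv.1 hYs).2.differentiable (by simp))
    m u
  have heq := H.shrinker_eq (m * u)
  rw [curvatureSS, hS, arcDeriv, norm_deriv_epicycle hm H, (hYY.const_mul _).deriv, smul_eq_mul]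
  have hw := hw0 (m * u)
  rw [← hY] at heq
  field_simp at heq ⊢
  linear_combination heq

/-! ### Homothetic shrinking -/

lemma arcDeriv_smul_left {F : Type*} [NormedAddCommGroup F] [NormedSpace ℝ F] {r : ℝ} (hr : 0 < r)
    (c : ℝ → ℂ) (f : ℝ → F) : arcDeriv (fun u => r • c u) f = fun u => r⁻¹ • arcDeriv c f u := by
  funext u
  rw [arcDeriv, arcDeriv, deriv_fun_const_smul_field, norm_smul, Real.norm_eq_abs, abs_of_pos hr,
    mul_inv, mul_smul]

lemma arcDeriv_const_smul {F : Type*} [NormedAddCommGroup F] [NormedSpace ℝ F] (r : ℝ)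
    (c : ℝ → ℂ) (f : ℝ → F) : arcDeriv c (fun u => r • f u) = fun u => r • arcDeriv c f u := by
  funext u
  rw [arcDeriv, arcDeriv, deriv_fun_const_smul_field, smul_comm]

lemma unitTangent_smul {r : ℝ} (hr : 0 < r) (c : ℝ → ℂ) :
    unitTangent (fun u => r • c u) = unitTangent c := by
  rw [unitTangent, arcDeriv_smul_left hr, arcDeriv_const_smul]
  funext u
  rw [smul_smul, inv_mul_cancel₀ hr.ne', one_smul, unitTangent]

lemma unitNormal_smul {r : ℝ} (hr : 0 < r) (c : ℝ → ℂ) :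
    unitNormal (fun u => r • c u) = unitNormal c := by
  unfold unitNormal
  rw [unitTangent_smul hr]

lemma curvatureSS_smul {r : ℝ} (hr : 0 < r) (c : ℝ → ℂ) (u : ℝ) :
    curvatureSS (fun u => r • c u) u = (r ^ 3)⁻¹ * curvatureSS c u := by
  have hk : curvature (fun u => r • c u) = fun u => r⁻¹ • curvature c u := by
    funext u
    rw [curvature, unitTangent_smul hr, unitNormal_smul hr, arcDeriv_smul_left hr,
      real_inner_smul_left, curvature, smul_eq_mul]
  rw [curvatureSS, hk, arcDeriv_smul_left hr, arcDeriv_const_smul, arcDeriv_smul_left hr,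
    arcDeriv_const_smul, arcDeriv_const_smul, curvatureSS]
  simp only [smul_eq_mul]
  field_simp

lemma isSmoothClosedCurve_smul {r : ℝ} (hr : r ≠ 0) {c : ℝ → ℂ} (hc : IsSmoothClosedCurve c) :
    IsSmoothClosedCurve (fun u => r • c u) where
  smooth := hc.smooth.const_smul r
  periodic := fun u => by simp only [hc.periodic u]
  immersed := fun u => by
    rw [deriv_fun_const_smul_field]
    exact smul_ne_zero hr (hc.immersed u)

/-- A curve that satisfies the profile equation shrinks homothetically. -/
lemma isHomotheticShrinker_of_profile {c : ℝ → ℂ} (hc : IsSmoothClosedCurve c) {σ : ℝ} (hσ : σ < 0)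
    (hprof : ∀ u, curvatureSS c u = -σ * inner ℝ (c u) (unitNormal c u)) :
    IsHomotheticShrinker c := by
  -- As `kₛₛ` scales with the power `-3`, the factor must solve `ρ' = σ ρ⁻³`, so `ρ⁴ = 1 + 4 σ t`,
  -- which vanishes at this `T`.
  set T : ℝ := (-4 * σ)⁻¹ with hT
  have hT0 : 0 < T := inv_pos.2 (by linarith)
  have hTσ : 4 * σ * T = -1 := by
    have := hσ.ne
    rw [hT]; field_simp
  have hbase : ∀ t ∈ Ico 0 T, 0 < 1 + 4 * σ * t := fun t ht => by nlinarith [ht.2]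
  set ρ : ℝ → ℝ := fun t => (1 + 4 * σ * t) ^ (1 / 4 : ℝ) with hρ
  have hρ0 : ∀ t ∈ Ico 0 T, 0 < ρ t := fun t ht => Real.rpow_pos_of_pos (hbase t ht) _
  have hρd : ∀ t ∈ Ico 0 T, HasDerivAt ρ (σ * (ρ t ^ 3)⁻¹) t := fun t ht => by
    have h1 : HasDerivAt (fun t => 1 + 4 * σ * t) (4 * σ) t := by
      simpa using ((hasDerivAt_id t).const_mul (4 * σ)).const_add 1
    refine (h1.rpow_const (p := (1 / 4 : ℝ)) (Or.inl (hbase t ht).ne')).congr_deriv ?_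
    have h3 : (ρ t ^ 3)⁻¹ = (1 + 4 * σ * t) ^ (1 / 4 - 1 : ℝ) := by
      rw [hρ, ← Real.rpow_natCast, ← Real.rpow_mul (hbase t ht).le, ← Real.rpow_neg (hbase t ht).le]
      norm_num
    rw [h3]
    ring
  refine ⟨hc, ⟨σ, hσ, hprof⟩, T, ρ, hT0, by simp [hρ], hρ0, ?_, ?_, ?_, ?_, ?_⟩
  · intro s hs t ht hst
    exact Real.rpow_lt_rpow (hbase t ht).le (by nlinarith) (by norm_num)
  · have hcont : Continuous ρ := (by fun_prop : Continuous fun t => 1 + 4 * σ * t).rpow_const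
      fun _ => Or.inr (by norm_num)
    have h0 : ρ T = 0 := by
      rw [hρ]
      simp only [hTσ]
      norm_num
    exact (hcont.tendsto' T 0 h0).mono_left nhdsWithin_le_nhds
  · have h1 : ContDiffOn ℝ ∞ (fun p : ℝ × ℝ => ρ p.1) (Ico 0 T ×ˢ univ) := fun p hp =>
      ContDiffAt.contDiffWithinAt (ContDiffAt.rpow_const_of_ne (by fun_prop)
        (hbase p.1 hp.1).ne')
    exact h1.smul (hc.smooth.comp contDiff_snd).contDiffOn
  · exact fun t ht => isSmoothClosedCurve_smul (hρ0 t ht).ne' hc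
  · intro t ht u
    have hd : HasDerivWithinAt (fun r => ρ r • c u) ((σ * (ρ t ^ 3)⁻¹) • c u) (Ico 0 T) t :=
      ((hρd t ht).smul_const (c u)).hasDerivWithinAt
    rw [hd.derivWithin (uniqueDiffOn_Ico 0 T t ht), unitNormal_smul (hρ0 t ht),
      curvatureSS_smul (hρ0 t ht), hprof, real_inner_smul_left]
    ring

lemma isHomotheticShrinker_epicycle (hm : 2 ≤ m) (hε : 0 < ε)
    (H : IsShrinkerProfile (m / (m - 1)) ε h w) : IsHomotheticShrinker (epicycle m h) :=
  isHomotheticShrinker_of_profile (isSmoothClosedCurve_epicycle hm H) (neg_lt_zero.2 hε) fun u => by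
    rw [curvatureSS_epicycle hm H, inner_epicycle_unitNormal hm H]
    ring

end Geometry

/-! ### Sets whose points of maximal modulus form a regular polygon -/

/-- The rotation angle of the regular `m`-gon, as a point of the unit circle. -/
noncomputable def rootOfUnity (m : ℕ) : Circle := Circle.exp (2 * Real.pi / m)

lemma isPrimitiveRoot_rootOfUnity {m : ℕ} (hm : m ≠ 0) :
    IsPrimitiveRoot (rootOfUnity m : ℂ) m := by
  have := Complex.isPrimitiveRoot_exp m hm
  rw [rootOfUnity, Circle.coe_exp]
  convert this using 2
  push_cast
  ring

/-- The points of maximal modulus of `K` are the vertices `ωʲ V` of a regular `m`-gon. -/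
structure HasPolygonalTop (K : Set ℂ) (m : ℕ) (V : ℂ) : Prop where
  ne_zero : V ≠ 0
  vertex_mem : ∀ j : ℕ, (rootOfUnity m : ℂ) ^ j * V ∈ K
  norm_le : ∀ z ∈ K, ‖z‖ ≤ ‖V‖
  eq_vertex : ∀ z ∈ K, ‖z‖ = ‖V‖ → ∃ j < m, z = (rootOfUnity m : ℂ) ^ j * V

lemma norm_rootOfUnity_pow_mul (m j : ℕ) (V : ℂ) : ‖(rootOfUnity m : ℂ) ^ j * V‖ = ‖V‖ := by
  rw [norm_mul, norm_pow, Circle.norm_coe, one_pow, one_mul]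

/-- The centroid of a regular polygon is the centre of its smallest enclosing disc. -/
lemma norm_sq_add_norm_sq_le_of_vertices {n : ℕ} (hn : 2 ≤ n) {V c : ℂ} {r : ℝ}
    (h : ∀ j : ℕ, dist ((rootOfUnity n : ℂ) ^ j * V) c ≤ r) : ‖V‖ ^ 2 + ‖c‖ ^ 2 ≤ r ^ 2 := by
  -- Averaging the squared distances over the vertices kills the cross term with `c`.
  have hsum : ∑ j ∈ Finset.range n, (rootOfUnity n : ℂ) ^ j * V = 0 := by
    rw [← Finset.sum_mul, (isPrimitiveRoot_rootOfUnity (by omega)).geom_sum_eq_zero (by omega),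
      zero_mul]
  have hinner : ∑ j ∈ Finset.range n, inner ℝ ((rootOfUnity n : ℂ) ^ j * V) c = 0 := by
    rw [← sum_inner, hsum, inner_zero_left]
  have hle : ∑ j ∈ Finset.range n,
      (‖V‖ ^ 2 + ‖c‖ ^ 2 - 2 * inner ℝ ((rootOfUnity n : ℂ) ^ j * V) c) ≤
      ∑ _j ∈ Finset.range n, r ^ 2 := by
    refine Finset.sum_le_sum fun j _ => ?_
    have h1 := h j
    rw [dist_eq_norm] at h1
    have h2 := norm_sub_sq_real ((rootOfUnity n : ℂ) ^ j * V) c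
    rw [norm_rootOfUnity_pow_mul] at h2
    have h3 := pow_le_pow_left₀ (norm_nonneg _) h1 2
    linarith
  rw [Finset.sum_sub_distrib, ← Finset.mul_sum, hinner] at hle
  simp only [Finset.sum_const, Finset.card_range, nsmul_eq_mul, mul_zero, sub_zero] at hle
  have hn0 : (0 : ℝ) < n := by exact_mod_cast (by omega : 0 < n)
  exact le_of_mul_le_mul_left hle hn0

namespace HasPolygonalTop

variable {K₁ K₂ : Set ℂ} {m n : ℕ} {V W : ℂ}

/-- The image of the disc of radius `‖V‖` about `0` contains all vertices of `K₂`. Together with the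
same bound for `f.symm`, this forces equality of the radii and `f 0 = 0`. -/
lemma norm_sq_add_le (h₁ : HasPolygonalTop K₁ m V) (h₂ : HasPolygonalTop K₂ n W) (hn : 2 ≤ n)
    (f : ℂ ≃ᵈ ℂ) (hf : f '' K₁ = K₂) :
    ‖W‖ ^ 2 + ‖f 0‖ ^ 2 ≤ (Dilation.ratio f * ‖V‖) ^ 2 := by
  refine norm_sq_add_norm_sq_le_of_vertices hn fun j => ?_
  obtain ⟨z, hz, hzj⟩ := hf.symm ▸ h₂.vertex_mem j
  rw [← hzj, Dilation.dist_eq, dist_zero_right]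
  exact mul_le_mul_of_nonneg_left (h₁.norm_le z hz) (by positivity)

lemma ratio_mul_norm_le (h₁ : HasPolygonalTop K₁ m V) (h₂ : HasPolygonalTop K₂ n W) (hm : 2 ≤ m)
    (f : ℂ ≃ᵈ ℂ) (hf : f '' K₁ = K₂) : Dilation.ratio f * ‖V‖ ≤ ‖W‖ := by
  have hf' : f.symm '' K₂ = K₁ := by
    rw [← hf, ← image_comp]
    simp
  have h := h₂.norm_sq_add_le h₁ hm f.symm hf'
  rw [DilationEquiv.ratio_symm, NNReal.coe_inv] at h
  have hr : (0 : ℝ) < Dilation.ratio f := Dilation.ratio_pos f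
  have h2 : ‖V‖ ≤ (Dilation.ratio f : ℝ)⁻¹ * ‖W‖ :=
    le_of_sq_le_sq (by linarith [sq_nonneg ‖f.symm 0‖]) (by positivity)
  calc _ ≤ (Dilation.ratio f : ℝ) * ((Dilation.ratio f : ℝ)⁻¹ * ‖W‖) := by gcongr
    _ = _ := by field_simp

lemma map_zero (h₁ : HasPolygonalTop K₁ m V) (h₂ : HasPolygonalTop K₂ n W) (hm : 2 ≤ m)
    (hn : 2 ≤ n) (f : ℂ ≃ᵈ ℂ) (hf : f '' K₁ = K₂) : f 0 = 0 := by
  have ha := h₁.norm_sq_add_le h₂ hn f hf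
  have hb := pow_le_pow_left₀ (by positivity) (h₁.ratio_mul_norm_le h₂ hm f hf) 2
  have : ‖f 0‖ ^ 2 = 0 := le_antisymm (by linarith) (sq_nonneg _)
  simpa using this

lemma ratio_mul_norm_eq (h₁ : HasPolygonalTop K₁ m V) (h₂ : HasPolygonalTop K₂ n W) (hm : 2 ≤ m)
    (hn : 2 ≤ n) (f : ℂ ≃ᵈ ℂ) (hf : f '' K₁ = K₂) : Dilation.ratio f * ‖V‖ = ‖W‖ := by
  have ha := h₁.norm_sq_add_le h₂ hn f hf
  exact le_antisymm (h₁.ratio_mul_norm_le h₂ hm f hf)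
    (le_of_sq_le_sq (by linarith [sq_nonneg ‖f 0‖]) (by positivity))

lemma image_top (h₁ : HasPolygonalTop K₁ m V) (h₂ : HasPolygonalTop K₂ n W) (hm : 2 ≤ m)
    (hn : 2 ≤ n) (f : ℂ ≃ᵈ ℂ) (hf : f '' K₁ = K₂) :
    f '' {z ∈ K₁ | ‖z‖ = ‖V‖} = {z ∈ K₂ | ‖z‖ = ‖W‖} := by
  have hnorm : ∀ z, ‖f z‖ = Dilation.ratio f * ‖z‖ := fun z => by
    rw [← dist_zero_right, ← h₁.map_zero h₂ hm hn f hf, Dilation.dist_eq, dist_zero_right]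
  have hr : (Dilation.ratio f : ℝ) ≠ 0 := by exact_mod_cast Dilation.ratio_ne_zero f
  have heq := h₁.ratio_mul_norm_eq h₂ hm hn f hf
  have hiff : ∀ z, ‖f z‖ = ‖W‖ ↔ ‖z‖ = ‖V‖ := fun z => by
    rw [hnorm, ← heq, mul_right_inj' hr]
  subst hf
  ext y
  constructor
  · rintro ⟨z, ⟨hz, hzV⟩, rfl⟩
    exact ⟨mem_image_of_mem f hz, (hiff z).2 hzV⟩
  · rintro ⟨⟨z, hz, rfl⟩, hy⟩
    exact ⟨z, ⟨hz, (hiff z).1 hy⟩, rfl⟩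

lemma ncard_top (h : HasPolygonalTop K₁ m V) (hm : m ≠ 0) :
    {z ∈ K₁ | ‖z‖ = ‖V‖}.ncard = m := by
  have heq : {z ∈ K₁ | ‖z‖ = ‖V‖} =
      ((Finset.range m).image fun j => (rootOfUnity m : ℂ) ^ j * V : Finset ℂ) := by
    ext z
    simp only [mem_ofPred_eq, Finset.coe_image, Finset.coe_range, mem_image, mem_Iio]
    constructor
    · rintro ⟨hz, hzV⟩
      obtain ⟨j, hj, rfl⟩ := h.eq_vertex z hz hzV
      exact ⟨j, hj, rfl⟩
    · rintro ⟨j, -, rfl⟩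
      exact ⟨h.vertex_mem j, norm_rootOfUnity_pow_mul m j V⟩
  rw [heq, ncard_coe_finset, Finset.card_image_of_injOn, Finset.card_range]
  intro i hi j hj hij
  exact (isPrimitiveRoot_rootOfUnity hm).pow_inj (Finset.mem_range.1 hi) (Finset.mem_range.1 hj)
    (mul_right_cancel₀ h.ne_zero hij)

lemma eq_of_similar (h₁ : HasPolygonalTop K₁ m V) (h₂ : HasPolygonalTop K₂ n W) (hm : 2 ≤ m)
    (hn : 2 ≤ n) (f : ℂ ≃ᵈ ℂ) (hf : f '' K₁ = K₂) : m = n := by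
  rw [← h₁.ncard_top (by omega), ← h₂.ncard_top (by omega), ← h₁.image_top h₂ hm hn f hf,
    ncard_image_of_injective _ f.injective]

lemma lineReflection_pi_div_two_apply (z : ℂ) :
    lineReflection (Real.pi / 2) z = -(starRingEnd ℂ) z := by
  rw [lineReflection, LinearIsometryEquiv.trans_apply, rotation_apply, Complex.conjLIE_apply,
    show 2 * (Real.pi / 2) = Real.pi by ring, Circle.coe_exp, Complex.exp_pi_mul_I, neg_one_mul]

/-- An isometry that preserves a set with polygonal top is a symmetry of the polygon. -/
lemma exists_mem_planeDihedralGroup (h : HasPolygonalTop K₁ m V) (hm : 2 ≤ m)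
    (hV : (starRingEnd ℂ) V = -V) (f : ℂ ≃ᵢ ℂ) (hf : f '' K₁ = K₁) :
    ∃ g ∈ planeDihedralGroup m (Real.pi / 2), ∀ z, f z = g z := by
  have h0 : f 0 = 0 := h.map_zero h hm hm f.toDilationEquiv hf
  obtain ⟨F, hF⟩ : ∃ F : ℂ ≃ₗᵢ[ℝ] ℂ, ∀ z, f z = F z :=
    ⟨f.toRealLinearIsometryEquivOfMapZero h0, fun z => rfl⟩
  have hVmem : V ∈ K₁ := by simpa using h.vertex_mem 0
  obtain ⟨j, -, hj⟩ := h.eq_vertex (f V) (hf ▸ mem_image_of_mem f hVmem) (by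
    rw [hF, LinearIsometryEquiv.norm_map])
  rw [hF] at hj
  have hrot : rotation (rootOfUnity m) ∈ planeDihedralGroup m (Real.pi / 2) :=
    Subgroup.subset_closure (by simp [rootOfUnity])
  have hrotj := pow_mem hrot j
  rw [← map_pow] at hrotj
  have hrefl : lineReflection (Real.pi / 2) ∈ planeDihedralGroup m (Real.pi / 2) :=
    Subgroup.subset_closure (by simp)
  -- A linear isometry is fixed by its orientation and the image of one vertex; in the reversing
  -- case `V` lies on the imaginary axis, whence the reflection axis `π / 2`.
  obtain ⟨a, rfl | rfl⟩ := linear_isometry_complex F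
  · refine ⟨_, hrotj, fun z => ?_⟩
    rw [rotation_apply] at hj
    rw [hF, rotation_apply, rotation_apply, mul_right_cancel₀ h.ne_zero hj, Circle.coe_pow]
  · refine ⟨_, mul_mem hrotj hrefl, fun z => ?_⟩
    rw [LinearIsometryEquiv.trans_apply, rotation_apply, Complex.conjLIE_apply, hV] at hj
    have ha : (a : ℂ) = -(rootOfUnity m : ℂ) ^ j := mul_right_cancel₀ h.ne_zero (by
      linear_combination -hj)
    rw [hF, LinearIsometryEquiv.trans_apply, rotation_apply, Complex.conjLIE_apply, ha,
      LinearIsometryEquiv.coe_mul, Function.comp_apply, rotation_apply,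
      lineReflection_pi_div_two_apply, Circle.coe_pow]
    ring

end HasPolygonalTop

/-! ### Symmetries of the epicyclic curves -/

section Symmetry

variable {m : ℕ} {ε : ℝ} {h w : ℝ → ℝ}

lemma odd_deriv_of_even {g : ℝ → ℝ} (hg : Function.Even g) : Function.Odd (deriv g) := fun x => by
  have := deriv_comp_neg g x
  rw [show (fun x => g (-x)) = g from funext hg] at this
  rw [this, neg_neg]

lemma epicycle_neg (H : IsShrinkerProfile (m / (m - 1)) ε h w) (u : ℝ) :
    epicycle m h (-u) = -(starRingEnd ℂ) (epicycle m h u) := by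
  have hp : phase m (-u) = (starRingEnd ℂ) (phase m u) := by
    rw [phase, phase, ← Complex.exp_conj]
    simp
  rw [epicycle, epicycle, mul_neg, H.even, odd_deriv_of_even H.even, hp, map_mul, map_sub, map_mul,
    Complex.conj_ofReal, Complex.conj_ofReal, Complex.conj_I]
  push_cast
  ring

/-- `(m - 1)(-2πj/m) = 2πj/m - 2πj`: moving the parameter back by `2π/m` rotates forward by `2π/m`.
-/
lemma phase_sub_nat (hm : 2 ≤ m) (u : ℝ) (j : ℕ) :
    phase m (u - j * (2 * Real.pi / m)) = (rootOfUnity m : ℂ) ^ j * phase m u := by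
  have hm0 : (m : ℂ) ≠ 0 := by exact_mod_cast (by omega : m ≠ 0)
  rw [phase, phase, rootOfUnity, Circle.coe_exp, ← Complex.exp_nat_mul, ← Complex.exp_add,
    Complex.exp_eq_exp_iff_exists_int]
  refine ⟨-j, ?_⟩
  push_cast
  field_simp
  ring

lemma epicycle_sub_nat (hm : 2 ≤ m) (H : IsShrinkerProfile (m / (m - 1)) ε h w) (u : ℝ) (j : ℕ) :
    epicycle m h (u - j * (2 * Real.pi / m)) = (rootOfUnity m : ℂ) ^ j * epicycle m h u := by
  have hm0 : (m : ℝ) ≠ 0 := by exact_mod_cast (by omega : m ≠ 0)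
  rw [epicycle, epicycle, phase_sub_nat hm,
    show (m : ℝ) * (u - j * (2 * Real.pi / m)) = m * u - j * (2 * Real.pi) by field_simp,
    H.periodic.sub_nat_mul_eq, (periodic_deriv H.periodic).sub_nat_mul_eq]
  ring

lemma conj_epicycle_zero (H : IsShrinkerProfile (m / (m - 1)) ε h w) :
    (starRingEnd ℂ) (epicycle m h 0) = -epicycle m h 0 := by
  have := epicycle_neg H 0
  rw [neg_zero] at this
  rw [← neg_eq_iff_eq_neg, ← this]

/-- The squared distance from the origin along the curve. -/
noncomputable def radiusSq (m : ℕ) (h : ℝ → ℝ) (x : ℝ) : ℝ :=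
  (m / (m - 1) * deriv h x) ^ 2 + h x ^ 2

lemma norm_epicycle_sq (u : ℝ) : ‖epicycle m h u‖ ^ 2 = radiusSq m h (m * u) := by
  rw [epicycle, norm_mul, norm_phase, mul_one, ← Complex.normSq_eq_norm_sq, Complex.normSq_apply,
    radiusSq, Complex.sub_re, Complex.sub_im, Complex.ofReal_re, Complex.ofReal_im,
    Complex.re_ofReal_mul, Complex.im_ofReal_mul, Complex.I_re, Complex.I_im]
  ring

lemma strictAntiOn_radiusSq (H : IsShrinkerProfile (m / (m - 1)) ε h w) :
    StrictAntiOn (radiusSq m h) (Icc 0 Real.pi) := by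
  -- `(l² h'² + h²)' = 2 h' (l² h'' + h)`, and the bracket is `w`.
  have hd : ∀ x, HasDerivAt (radiusSq m h) (2 * deriv h x * w x) x := fun x => by
    have h1 := (H.smooth.differentiable (by simp) x).hasDerivAt
    have h2 := (H.contDiff_deriv.differentiable (by simp) x).hasDerivAt
    refine (((h2.const_mul (m / (m - 1) : ℝ)).pow 2).add (h1.pow 2)).congr_deriv ?_
    rw [H.radius_eq]
    push_cast
    ring
  refine strictAntiOn_of_deriv_neg (convex_Icc _ _)
    (fun x _ => (hd x).continuousAt.continuousWithinAt) fun x hx => ?_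
  rw [interior_Icc] at hx
  rw [(hd x).deriv]
  nlinarith [mul_pos (neg_pos.2 (H.deriv_neg x hx)) (H.radius_pos x)]

lemma radiusSq_eq_arccos_cos (H : IsShrinkerProfile (m / (m - 1)) ε h w) (x : ℝ) :
    radiusSq m h x = radiusSq m h (Real.arccos (Real.cos x)) := by
  refine (apply_arccos_cos (fun x => ?_) (fun x => ?_) x).symm
  · rw [radiusSq, radiusSq, H.even, odd_deriv_of_even H.even, mul_neg, neg_sq]
  · rw [radiusSq, radiusSq, H.periodic, periodic_deriv H.periodic]

lemma hasPolygonalTop_epicycle (hm : 2 ≤ m) (H : IsShrinkerProfile (m / (m - 1)) ε h w) :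
    HasPolygonalTop (range (epicycle m h)) m (epicycle m h 0) := by
  have hanti := strictAntiOn_radiusSq H
  have hpi := Real.pi_pos
  have h0mem : (0 : ℝ) ∈ Icc 0 Real.pi := ⟨le_rfl, hpi.le⟩
  have hmem : ∀ x, Real.arccos (Real.cos x) ∈ Icc 0 Real.pi := fun x =>
    ⟨Real.arccos_nonneg _, Real.arccos_le_pi _⟩
  have hnorm0 : ‖epicycle m h 0‖ ^ 2 = radiusSq m h 0 := by rw [norm_epicycle_sq, mul_zero]
  have hm0 : (m : ℝ) ≠ 0 := by exact_mod_cast (by omega : m ≠ 0)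
  refine ⟨?_, fun j => ⟨0 - j * (2 * Real.pi / m), epicycle_sub_nat hm H 0 j⟩, ?_, ?_⟩
  · intro h0
    have h1 := hanti h0mem ⟨hpi.le, le_rfl⟩ hpi
    rw [← hnorm0, h0, norm_zero] at h1
    have h2 : 0 ≤ radiusSq m h Real.pi := by rw [radiusSq]; positivity
    linarith
  · rintro _ ⟨u, rfl⟩
    refine le_of_sq_le_sq ?_ (norm_nonneg _)
    rw [hnorm0, norm_epicycle_sq, radiusSq_eq_arccos_cos H]
    exact hanti.antitoneOn h0mem (hmem _) (hmem _).1
  · rintro _ ⟨u, rfl⟩ hu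
    have h1 : radiusSq m h (Real.arccos (Real.cos (m * u))) = radiusSq m h 0 := by
      rw [← radiusSq_eq_arccos_cos H, ← norm_epicycle_sq, hu, hnorm0]
    have h2 := hanti.injOn (hmem _) h0mem h1
    rw [Real.arccos_eq_zero] at h2
    obtain ⟨k, hk⟩ := (Real.cos_eq_one_iff (m * u)).1 (le_antisymm (Real.cos_le_one _) h2)
    have hmZ : (m : ℤ) ≠ 0 := by exact_mod_cast (by omega : m ≠ 0)
    -- Equality holds only at `u = 2πk/m`; by the sign in `epicycle_sub_nat` the vertex index is
    -- `-k` modulo `m`, and the quotient accounts for whole periods.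
    set j := ((-k) % m).toNat with hj
    have hjz : (j : ℤ) = (-k) % m := Int.toNat_of_nonneg (Int.emod_nonneg _ hmZ)
    have hdm := Int.emod_add_mul_ediv (-k) m
    rw [← hjz] at hdm
    refine ⟨j, ?_, ?_⟩
    · have := Int.emod_lt_of_pos (-k) (by omega : (0 : ℤ) < m)
      omega
    · rw [← epicycle_sub_nat hm H 0 j]
      have hu' : u = 0 - j * (2 * Real.pi / m) + ((-((-k) / (m : ℤ)) : ℤ) : ℝ) * (2 * Real.pi) := by
        have hdr : (j : ℝ) + m * (((-k) / (m : ℤ) : ℤ) : ℝ) = -k := by exact_mod_cast hdm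
        have : u = k * (2 * Real.pi) / m := by
          rw [hk]; field_simp
        rw [this, show (k : ℝ) = -(j + m * (((-k) / (m : ℤ) : ℤ) : ℝ)) by rw [hdr, neg_neg]]
        push_cast
        field_simp
        ring
      conv_lhs => rw [hu']
      exact (isSmoothClosedCurve_epicycle hm H).periodic.int_mul _ _

/-- `φ` is a rotation or a reflection of the circle `ℝ / 2πℤ`. -/
def IsAffineReparam (φ : ℝ → ℝ) : Prop :=
  ∃ s b : ℝ, (s = 1 ∨ s = -1) ∧ ∀ u, φ u = s * u + b

lemma IsAffineReparam.isCircleReparam {φ : ℝ → ℝ} (hφ : IsAffineReparam φ) :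
    IsCircleReparam φ := by
  obtain ⟨s, b, hs, hφ⟩ := hφ
  obtain rfl : φ = fun u => s * u + b := funext hφ
  refine ⟨by fun_prop, fun u => ?_, ?_⟩
  · have : HasDerivAt (fun u : ℝ => s * u + b) s u := by
      simpa using ((hasDerivAt_id u).const_mul s).add_const b
    rw [this.deriv]
    rcases hs with rfl | rfl <;> norm_num
  · rcases hs with rfl | rfl
    · left; intro u; ring
    · right; intro u; ring

/-- Affine reparametrisations are closed under composition and inversion by explicit formulas, so
closure induction reduces the claim to the two generators. -/
lemma exists_reparam_of_mem_planeDihedralGroup {c : ℝ → ℂ} {β : ℝ}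
    (hrot : ∃ φ, IsAffineReparam φ ∧ ∀ u, (rootOfUnity m : ℂ) * c u = c (φ u))
    (hrefl : ∃ φ, IsAffineReparam φ ∧ ∀ u, lineReflection β (c u) = c (φ u))
    {g : ℂ ≃ₗᵢ[ℝ] ℂ} (hg : g ∈ planeDihedralGroup m β) :
    ∃ φ, IsAffineReparam φ ∧ ∀ u, g (c u) = c (φ u) := by
  induction hg using Subgroup.closure_induction with
  | mem g hg =>
    rcases hg with rfl | rfl
    · exact hrot
    · exact hrefl
  | one => exact ⟨id, ⟨1, 0, by simp⟩, fun u => rfl⟩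
  | mul g₁ g₂ _ _ h₁ h₂ =>
    obtain ⟨φ₁, ⟨s₁, b₁, hs₁, hφ₁⟩, h₁⟩ := h₁
    obtain ⟨φ₂, ⟨s₂, b₂, hs₂, hφ₂⟩, h₂⟩ := h₂
    refine ⟨φ₁ ∘ φ₂, ⟨s₁ * s₂, s₁ * b₂ + b₁, ?_, fun u => ?_⟩, fun u => ?_⟩
    · rcases hs₁ with rfl | rfl <;> rcases hs₂ with rfl | rfl <;> norm_num
    · rw [Function.comp_apply, hφ₁, hφ₂]; ring
    · rw [LinearIsometryEquiv.coe_mul, Function.comp_apply, h₂, h₁, Function.comp_apply]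
  | inv g _ h =>
    obtain ⟨φ, ⟨s, b, hs, hφ⟩, h⟩ := h
    refine ⟨fun u => s * u + -(s * b), ⟨s, -(s * b), hs, fun u => rfl⟩, fun u => ?_⟩
    have hu : φ (s * u + -(s * b)) = u := by
      rw [hφ]
      rcases hs with rfl | rfl <;> ring
    have := h (s * u + -(s * b))
    rw [hu] at this
    rw [← this]
    exact g.symm_apply_apply _

lemma hasDihedralSymmetry_epicycle (hm : 2 ≤ m) (H : IsShrinkerProfile (m / (m - 1)) ε h w) :
    HasDihedralSymmetry (epicycle m h) m := by
  refine ⟨Real.pi / 2, fun g hg => ?_, fun f hf =>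
    (hasPolygonalTop_epicycle hm H).exists_mem_planeDihedralGroup hm (conj_epicycle_zero H) f hf⟩
  obtain ⟨φ, hφ, hgφ⟩ := exists_reparam_of_mem_planeDihedralGroup (c := epicycle m h)
    ⟨fun u => u - (2 * Real.pi / m), ⟨1, -(2 * Real.pi / m), Or.inl rfl, fun u => by ring⟩,
      fun u => by simpa using (epicycle_sub_nat hm H u 1).symm⟩
    ⟨fun u => -u, ⟨-1, 0, Or.inr rfl, fun u => by ring⟩, fun u => by
      rw [HasPolygonalTop.lineReflection_pi_div_two_apply, epicycle_neg H]⟩ hg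
  exact ⟨φ, hφ.isCircleReparam, hgφ⟩

end Symmetry

/-! ### Passage to large `m` and conclusion -/

lemma exists_nat_forall_exists_profile : ∃ m₀ : ℕ, ∀ m > m₀, ∃ (ε : ℝ) (h w : ℝ → ℝ),
    0 < ε ∧ IsShrinkerProfile (m / (m - 1)) ε h w := by
  have hl : Tendsto (fun m : ℕ => (m : ℝ) / (m - 1)) atTop (𝓝 1) := by
    have h1 : Tendsto (fun m : ℕ => 1 + ((m : ℝ) - 1)⁻¹) atTop (𝓝 (1 + 0)) :=
      tendsto_const_nhds.add (tendsto_inv_atTop_zero.comp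
        (tendsto_atTop_add_const_right _ (-1) tendsto_natCast_atTop_atTop))
    rw [add_zero] at h1
    refine h1.congr' ?_
    filter_upwards [eventually_ge_atTop 2] with m hm
    have := (cast_sub_one_pos hm).ne'
    field_simp
    ring
  -- This `δ` solves `l ^ 2 = 1 + δ ^ 2` for `l = m / (m - 1)`.
  have hδ : Tendsto (fun m : ℕ => √(((m : ℝ) / (m - 1)) ^ 2 - 1)) atTop (𝓝[>] 0) := by
    refine tendsto_nhdsWithin_iff.2 ⟨?_, ?_⟩
    · have := ((hl.pow 2).sub_const 1).sqrt
      simpa using this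
    · filter_upwards [eventually_ge_atTop 2] with m hm
      have h1 := cast_sub_one_pos hm
      have h2 : 1 < (m : ℝ) / (m - 1) := by rw [one_lt_div h1]; linarith
      exact Real.sqrt_pos.2 (by nlinarith)
  obtain ⟨m₀, hm₀⟩ := eventually_atTop.1
    ((hδ.eventually eventually_exists_profile).and (eventually_ge_atTop 2))
  refine ⟨m₀, fun m hm => ?_⟩
  obtain ⟨h1, h2⟩ := hm₀ m (le_of_lt hm)
  refine h1 _ ?_
  have h3 := cast_sub_one_pos h2
  have h4 : 1 < (m : ℝ) / (m - 1) := by rw [one_lt_div h3]; linarith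
  rw [Real.sq_sqrt (by nlinarith)]
  ring

end EpicyclicShrinker

open EpicyclicShrinker in
theorem theorem2 :
    ∃ (m₀ : ℕ) (γ : ℕ → ℝ → ℂ),
      (∀ m > m₀, IsHomotheticShrinker (γ m) ∧ HasDihedralSymmetry (γ m) m) ∧
      (∀ m > m₀, ∀ n > m₀, m ≠ n → ¬ AreSimilar (γ m) (γ n)) := by
  obtain ⟨m₀, hm₀⟩ := exists_nat_forall_exists_profile
  choose! ε h w hε H using hm₀
  have two_le : ∀ m > max m₀ 1, 2 ≤ m := fun m hm => (le_max_right m₀ 1).trans_lt hm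
  have profile : ∀ m > max m₀ 1, IsShrinkerProfile (m / (m - 1)) (ε m) (h m) (w m) := fun m hm =>
    H m ((le_max_left m₀ 1).trans_lt hm)
  -- The maximum with `1` ensures `m ≥ 2`, so that `m - 1 > 0` and the vertices sum to zero.
  refine ⟨max m₀ 1, fun m => epicycle m (h m), fun m hm => ⟨?_, ?_⟩, fun m hm n hn hmn => ?_⟩
  · exact isHomotheticShrinker_epicycle (two_le m hm) (hε m ((le_max_left m₀ 1).trans_lt hm))
      (profile m hm)
  · exact hasDihedralSymmetry_epicycle (two_le m hm) (profile m hm)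
  · rintro ⟨f, hf⟩
    exact hmn ((hasPolygonalTop_epicycle (two_le m hm) (profile m hm)).eq_of_similar
      (hasPolygonalTop_epicycle (two_le n hn) (profile n hn)) (two_le m hm) (two_le n hn) f hf)
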